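/- Let $M$ be a compact smooth manifold without boundary and let $dx$ be a finite Borel measure on $M$ that is positive on non-empty open sets (for instance a Riemannian volume). Smoothness of maps between (subsets and quotients of) spaces of smooth functions is understood in the usual sense of the Fréchet space $C^\infty(M)$: smooth finite-dimensional families $(u,x)\mapsto p_u(x)$ are mapped to smooth families. Let $$\mathcal P_+(M)=\Big\{\rho\in C^\infty(M):\rho>0,\ \int\rho\,dx=1\Big\},\qquad T^*\mathcal P(M)=\{(\rho,S):\rho\in\mathcal P_+(M),\ S\in C^\infty(M)/\mathbb R\},$$ with the canonical form $\omega^W\big((\dot\rho_1,\dot S_1),(\dot\rho_2,\dot S_2)\big)=\int(\dot\rho_1\dot S_2-\dot\rho_2\dot S_1)\,dx$, where $\int\dot\rho_i\,dx=0$ and $\dot S_i\in C^\infty(M)/\mathbb R$. Let $\mathcal F$ be a real functional on an open set $D\subseteq C^\infty(M)$ containing $\mathcal P_+(M)$, with $L^2$ first variation $\delta\mathcal F:D\to C^\infty(M)$, and assume that $\delta\mathcal F$ is smooth and invertible, i.e. a bijection of $D$ onto $C^\infty(M)$ with smooth inverse. Let $\delta^2\mathcal F(\eta):C^\infty(M)\to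 C^\infty(M)$ be the derivative of $\delta\mathcal F$ at $\eta\in D$. Let $\mathcal C(M)$ be the set of pairs $$\eta=\delta\mathcal F^{-1}\big(\tfrac12(\delta\mathcal F(\rho)+S)\big),\qquad \eta^*=\delta\mathcal F^{-1}\big(\tfrac12(\delta\mathcal F(\rho)-S)\big),\qquad (\rho,S)\in T^*\mathcal P(M);$$ since $S$ is given up to an additive constant, two pairs $(\eta,\eta^*)$, $(\tilde\eta,\tilde\eta^*)$ are identified when $\delta\mathcal F(\tilde\eta)=\delta\mathcal F(\eta)+k$ and $\delta\mathcal F(\tilde\eta^*)=\delta\mathcal F(\eta^*)-k$ for some constant $k\in\mathbb R$. For $(\eta,\eta^*)\in\mathcal C(M)$ put $\rho=\delta\mathcal F^{-1}(\delta\mathcal F(\eta)+\delta\mathcal F(\eta^*))$ and $$\sigma(\eta,\eta^*)=-\tfrac12\,[\delta^2\mathcal F(\eta)]^{-1}\,\delta^2\mathcal F(\rho)\,[\delta^2\mathcal F(\eta^*)]^{-1},$$ $$\omega^{\mathcal C}_{(\eta,\eta^*)}\big((\dot\eta_1,\dot\eta_1^*),(\dot\eta_2,\dot\eta_2^*)\big)=\int\Big(\big(\sigma(\eta,\eta^*)^{-1}\dot\eta_1\big)\,\dot\eta_2^*-\big(\sigma(\eta,\eta^*)^{-1}\dot\eta_2\big)\,\dot\eta_1^*\Big)dx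 .$$ Then all operators $\delta^2\mathcal F(\eta)$, $\eta\in D$, and $\sigma(\eta,\eta^*)$, $(\eta,\eta^*)\in\mathcal C(M)$, are bijective; $\omega^{\mathcal C}$ and $\omega^W$ are (weak) symplectic forms (smooth, skew-symmetric, bilinear, closed and non-degenerate) on $\mathcal C(M)$ and $T^*\mathcal P(M)$, and the generalized Hopf–Cole transformation $s:(\eta,\eta^*)\mapsto(\rho,S)$, $$\delta\mathcal F(\rho)=\delta\mathcal F(\eta)+\delta\mathcal F(\eta^*),\qquad S=\delta\mathcal F(\eta)-\delta\mathcal F(\eta^*),$$ is a symplectomorphism from $(\mathcal C(M),\omega^{\mathcal C})$ onto $(T^*\mathcal P(M),\omega^W)$: a diffeomorphism with $\omega^W(ds\,X,ds\,Y)=\omega^{\mathcal C}(X,Y)$ for all tangent vectors $X,Y$. -/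

import Mathlib

open scoped Manifold ContDiff Topology
open MeasureTheory Diffeology

noncomputable section

/-! ### Subspaces, products and quotients of diffeological spaces -/

/-- The subspace diffeology: a map into a subtype is a plot iff it is a plot of the ambient
space. -/
instance HopfCole.instDiffeologicalSpaceSubtype {Z : Type*} [DiffeologicalSpace Z]
    (P : Z → Prop) : DiffeologicalSpace (Subtype P) where
  plots n := {p | IsPlot (fun u : EuclideanSpace ℝ (Fin n) => (p u : Z))}
  constant_plots x := isPlot_const
  plot_reparam hp hf := isPlot_reparam hp hf
  locality {n p} hp := DiffeologicalSpace.locality fun x => by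
    obtain ⟨u, hu, hx, h⟩ := hp x
    exact ⟨u, hu, hx, fun {m f} hf hf' => h hf hf'⟩

/-- The product diffeology: plots are pairs of plots. -/
instance HopfCole.instDiffeologicalSpaceProd {Y Z : Type*} [DiffeologicalSpace Y]
    [DiffeologicalSpace Z] : DiffeologicalSpace (Y × Z) where
  plots n := {p | IsPlot (fun u : EuclideanSpace ℝ (Fin n) => (p u).1) ∧
    IsPlot (fun u : EuclideanSpace ℝ (Fin n) => (p u).2)}
  constant_plots x := ⟨isPlot_const, isPlot_const⟩
  plot_reparam hp hf := ⟨isPlot_reparam hp.1 hf, isPlot_reparam hp.2 hf⟩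
  locality {n p} hp := by
    refine ⟨DiffeologicalSpace.locality fun x => ?_, DiffeologicalSpace.locality fun x => ?_⟩
    · obtain ⟨u, hu, hx, h⟩ := hp x
      exact ⟨u, hu, hx, fun {m f} hf hf' => (h hf hf').1⟩
    · obtain ⟨u, hu, hx, h⟩ := hp x
      exact ⟨u, hu, hx, fun {m f} hf hf' => (h hf hf').2⟩

/-- The quotient diffeology: the finest diffeology for which the projection is smooth. -/
instance HopfCole.instDiffeologicalSpaceQuotient {Z : Type*} [DiffeologicalSpace Z]
    (r : Setoid Z) : DiffeologicalSpace (Quotient r) :=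
  DiffeologicalSpace.generateFrom
    {q | ∃ p : EuclideanSpace ℝ (Fin q.1) → Z, IsPlot p ∧ q.2 = fun u => Quotient.mk r (p u)}

namespace HopfCole

/-! ### The space of smooth functions -/

/-- `C^∞(M)`, the smooth real functions on a `d`-dimensional manifold without boundary. -/
abbrev SmoothFn (d : ℕ) (M : Type*) [TopologicalSpace M]
    [ChartedSpace (EuclideanSpace ℝ (Fin d)) M] : Type _ :=
  ContMDiffMap (𝓡 d) 𝓘(ℝ, ℝ) M ℝ ∞

/-- The smooth structure of `C^∞(M)`: a family `p u`, `u ∈ ℝⁿ`, of smooth functions is smooth iff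
`(u, x) ↦ p u x` is smooth on `ℝⁿ × M`. For compact `M` a map between open subsets of `C^∞(M)`
is smooth for this structure iff it is smooth in the sense of Fréchet spaces, and the D-topology
is the Fréchet topology. -/
instance instDiffeologicalSpaceSmoothFn {d : ℕ} {M : Type*} [TopologicalSpace M]
    [ChartedSpace (EuclideanSpace ℝ (Fin d)) M] : DiffeologicalSpace (SmoothFn d M) :=
  .ofCorePlotsOn {
    isPlotOn := fun {n u} _ p => ContMDiffOn (𝓘(ℝ, EuclideanSpace ℝ (Fin n)).prod (𝓡 d)) 𝓘(ℝ, ℝ) ∞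
      (fun z : EuclideanSpace ℝ (Fin n) × M => p z.1 z.2) (u ×ˢ Set.univ)
    isPlotOn_congr := fun {n u} _ {p q} h =>
      contMDiffOn_congr (fun z hz => by rw [h hz.1])
    isPlot := fun {n} p => ContMDiff (𝓘(ℝ, EuclideanSpace ℝ (Fin n)).prod (𝓡 d)) 𝓘(ℝ, ℝ) ∞
      (fun z : EuclideanSpace ℝ (Fin n) × M => p z.1 z.2)
    isPlotOn_univ := by
      intro n p
      rw [Set.univ_prod_univ, contMDiffOn_univ]
    isPlot_const := fun f => f.contMDiff.comp contMDiff_snd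
    isPlotOn_reparam := by
      intro n m u v hu hv p f h hp hf
      refine ContMDiffOn.comp (t := u ×ˢ Set.univ)
        (f := fun z : EuclideanSpace ℝ (Fin m) × M => (f z.1, z.2)) hp ?_ ?_
      · exact (hf.contMDiffOn.comp contMDiffOn_fst (fun z hz => hz.1)).prodMk contMDiffOn_snd
      · exact fun z hz => ⟨h hz.1, trivial⟩
    locality := by
      intro n u hu p hp z hz
      obtain ⟨v, hv, hzv, h⟩ := hp z.1 hz.1
      exact ((h z ⟨hzv, trivial⟩).contMDiffAt
        ((hv.prod isOpen_univ).mem_nhds ⟨hzv, trivial⟩)).contMDiffWithinAt }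

section

variable {d : ℕ} {M : Type*} [TopologicalSpace M] [ChartedSpace (EuclideanSpace ℝ (Fin d)) M]

open Classical in
/-- The velocity at `t = 0` of a curve in `C^∞(M)`: the smooth function `w` with
`w(x) = ∂ₜ c(t)(x)` at `t = 0` for all `x` (and `0` if there is none, which does not occur for a
smooth curve). -/
def velocity (c : ℝ → SmoothFn d M) : SmoothFn d M :=
  if h : ∃ w : SmoothFn d M, ∀ x, HasDerivAt (fun t => c t x) (w x) 0 then h.choose else 0

/-- The velocity at `t = 0` of a curve of pairs of smooth functions. -/
def velocityPair (c : ℝ → SmoothFn d M × SmoothFn d M) : SmoothFn d M × SmoothFn d M :=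
  (velocity fun t => (c t).1, velocity fun t => (c t).2)

end

/-! ### Phase spaces -/

/-- A phase space whose points are pairs of smooth functions that belong to a set `carrier`, taken
up to an equivalence relation `rel`. -/
structure PhaseSpace (d : ℕ) (M : Type*) [TopologicalSpace M]
    [ChartedSpace (EuclideanSpace ℝ (Fin d)) M] where
  carrier : Set (SmoothFn d M × SmoothFn d M)
  rel : Setoid carrier

namespace PhaseSpace

variable {d : ℕ} {M : Type*} [TopologicalSpace M] [ChartedSpace (EuclideanSpace ℝ (Fin d)) M]

/-- The points of the phase space, with the quotient of the subspace diffeology. -/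
abbrev Point (A : PhaseSpace d M) : Type _ := Quotient A.rel

/-- The velocity at `t = 0` of a curve of representatives. -/
def vel (A : PhaseSpace d M) (c : ℝ → A.carrier) : SmoothFn d M × SmoothFn d M :=
  velocityPair fun t => (c t : SmoothFn d M × SmoothFn d M)

/-- The tangent vectors of `carrier` at `z`: the velocities of smooth curves in `carrier`
through `z`. -/
def tangent (A : PhaseSpace d M) (z : A.carrier) : Set (SmoothFn d M × SmoothFn d M) :=
  {v | ∃ c : ℝ → A.carrier, DSmooth c ∧ c 0 = z ∧ A.vel c = v}

/-- The vertical tangent vectors at `z`: the velocities of smooth curves through `z` that stay in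
the equivalence class of `z`. The tangent space of the quotient at the class of `z` is
`tangent z` modulo `vertical z`. -/
def vertical (A : PhaseSpace d M) (z : A.carrier) : Set (SmoothFn d M × SmoothFn d M) :=
  {v | ∃ c : ℝ → A.carrier, DSmooth c ∧ c 0 = z ∧ (∀ t, A.rel (c t) z) ∧ A.vel c = v}

/-- The coefficient `(p^*Ω)_u(a, b)` of the pull-back of the 2-form `Ω` by an `n`-parameter
family `p`. -/
def pullbackCoeff (A : PhaseSpace d M)
    (Ω : A.carrier → SmoothFn d M × SmoothFn d M → SmoothFn d M × SmoothFn d M → ℝ)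
    {n : ℕ} (p : EuclideanSpace ℝ (Fin n) → A.carrier) (a b u : EuclideanSpace ℝ (Fin n)) : ℝ :=
  Ω (p u) (A.vel fun t => p (u + t • a)) (A.vel fun t => p (u + t • b))

/-- `Ω` is a (weak) symplectic form on the phase space `carrier / rel`: a skew bilinear form on
tangent vectors which descends to the quotient, is non-degenerate there, is smooth, and is closed.
Smoothness and closedness are those of all its pull-backs to `ℝⁿ`. -/
structure IsSymplecticForm (A : PhaseSpace d M)
    (Ω : A.carrier → SmoothFn d M × SmoothFn d M → SmoothFn d M × SmoothFn d M → ℝ) : Prop where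
  add_left : ∀ z, ∀ v ∈ A.tangent z, ∀ v' ∈ A.tangent z, ∀ w ∈ A.tangent z,
    Ω z (v + v') w = Ω z v w + Ω z v' w
  smul_left : ∀ z, ∀ (r : ℝ), ∀ v ∈ A.tangent z, ∀ w ∈ A.tangent z, Ω z (r • v) w = r * Ω z v w
  skew : ∀ z, ∀ v ∈ A.tangent z, ∀ w ∈ A.tangent z, Ω z v w = -Ω z w v
  /-- The value depends only on the projections of the curves to the quotient. -/
  descends : ∀ c₁ c₂ c₁' c₂' : ℝ → A.carrier, DSmooth c₁ → DSmooth c₂ → DSmooth c₁' →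
    DSmooth c₂' → c₁ 0 = c₂ 0 → c₁' 0 = c₂' 0 → (∀ t, A.rel (c₁ t) (c₁' t)) →
    (∀ t, A.rel (c₂ t) (c₂' t)) →
    Ω (c₁ 0) (A.vel c₁) (A.vel c₂) = Ω (c₁' 0) (A.vel c₁') (A.vel c₂')
  /-- A tangent vector paired to zero with all others vanishes in the quotient. -/
  nondegenerate : ∀ z, ∀ v ∈ A.tangent z, (∀ w ∈ A.tangent z, Ω z v w = 0) → v ∈ A.vertical z
  smooth : ∀ (n : ℕ) (p : EuclideanSpace ℝ (Fin n) → A.carrier), IsPlot p → ∀ a b,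
    ContDiff ℝ ∞ (A.pullbackCoeff Ω p a b)
  /-- `d(p^*Ω)(a, b, c) = 0`. -/
  closed : ∀ (n : ℕ) (p : EuclideanSpace ℝ (Fin n) → A.carrier), IsPlot p → ∀ a b c u,
    fderiv ℝ (A.pullbackCoeff Ω p b c) u a + fderiv ℝ (A.pullbackCoeff Ω p c a) u b +
      fderiv ℝ (A.pullbackCoeff Ω p a b) u c = 0

/-- The map of representatives `f` induces a symplectomorphism `(A, ΩA) → (B, ΩB)`: both forms
are symplectic, `f` is smooth and descends to a diffeomorphism of the quotients, and
`ΩB(df(X), df(Y)) = ΩA(X, Y)`. -/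
structure IsSymplectomorphism (A B : PhaseSpace d M)
    (ΩA : A.carrier → SmoothFn d M × SmoothFn d M → SmoothFn d M × SmoothFn d M → ℝ)
    (ΩB : B.carrier → SmoothFn d M × SmoothFn d M → SmoothFn d M × SmoothFn d M → ℝ)
    (f : A.carrier → B.carrier) : Prop where
  symplectic_source : A.IsSymplecticForm ΩA
  symplectic_target : B.IsSymplecticForm ΩB
  smooth : DSmooth f
  diffeo : ∃ e : A.Point ≃ B.Point,
    (∀ z, e (Quotient.mk A.rel z) = Quotient.mk B.rel (f z)) ∧ DSmooth e ∧ DSmooth e.symm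
  pullback : ∀ c₁ c₂ : ℝ → A.carrier, DSmooth c₁ → DSmooth c₂ → c₁ 0 = c₂ 0 →
    ΩB (f (c₁ 0)) (B.vel fun t => f (c₁ t)) (B.vel fun t => f (c₂ t)) =
      ΩA (c₁ 0) (A.vel c₁) (A.vel c₂)

end PhaseSpace

/-! ### The Wasserstein cotangent bundle -/

section

variable {d : ℕ} {M : Type*} [TopologicalSpace M] [ChartedSpace (EuclideanSpace ℝ (Fin d)) M]
  [MeasurableSpace M]

/-- `P₊(M)`, the smooth strictly positive probability densities with respect to `μ`. -/
def densities (μ : Measure M) : Set (SmoothFn d M) :=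
  {ρ | (∀ x, 0 < ρ x) ∧ ∫ x, ρ x ∂μ = 1}

/-- `T^*P(M) = {(ρ, S) : ρ ∈ P₊(M), S ∈ C^∞(M) / ℝ}`. -/
def cotangentBundle (μ : Measure M) : PhaseSpace d M where
  carrier := {q | q.1 ∈ densities μ}
  rel :=
    { r := fun q q' => q.1.1 = q'.1.1 ∧ ∃ k : ℝ, ∀ x, q'.1.2 x = q.1.2 x + k
      iseqv :=
        { refl := fun q => ⟨rfl, 0, fun x => (add_zero _).symm⟩
          symm := fun {q q'} h => by
            obtain ⟨h₁, k, h₂⟩ := h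
            exact ⟨h₁.symm, -k, fun x => by rw [h₂ x]; ring⟩
          trans := fun {q q' q''} h h' => by
            obtain ⟨h₁, k, h₂⟩ := h
            obtain ⟨h₁', k', h₂'⟩ := h'
            exact ⟨h₁.trans h₁', k + k', fun x => by rw [h₂' x, h₂ x]; ring⟩ } }

/-- The canonical form `∫ (ρ̇₁ Ṡ₂ - ρ̇₂ Ṡ₁) dx` on `T^*P(M)`. -/
def wassersteinForm (μ : Measure M) (_ : (cotangentBundle (d := d) μ).carrier)
    (v w : SmoothFn d M × SmoothFn d M) : ℝ :=
  ∫ x, (v.1 x * w.2 x - w.1 x * v.2 x) ∂μ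

/-! ### Potentials with invertible first variation -/

/-- A potential energy `F` on an open set `dom` of smooth functions that contains the probability
densities, together with its first variation (`L²` gradient) `δF : dom → C^∞(M)`, which is smooth
and invertible: a bijection of `dom` onto `C^∞(M)` with smooth inverse. (The values of `F` and
`δF` off `dom` play no role.) -/
structure InvertiblePotential (d : ℕ) {M : Type*} [TopologicalSpace M]
    [ChartedSpace (EuclideanSpace ℝ (Fin d)) M] [MeasurableSpace M] (μ : Measure M) where
  dom : Set (SmoothFn d M)
  F : SmoothFn d M → ℝ
  δF : SmoothFn d M → SmoothFn d M
  isOpen_dom : IsOpen[dTopology] dom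
  densities_subset : densities μ ⊆ dom
  isFirstVariation : ∀ η ∈ dom, ∀ v : SmoothFn d M,
    HasDerivAt (fun t : ℝ => F (η + t • v)) (∫ x, δF η x * v x ∂μ) 0
  smooth_δF : DSmooth fun η : dom => δF η
  bijOn_δF : Set.BijOn δF dom Set.univ
  smooth_inv : DSmooth (Function.invFunOn δF dom)

namespace InvertiblePotential

variable {μ : Measure M} (Φ : InvertiblePotential d μ)

/-- `(δF)⁻¹ : C^∞(M) → dom`. -/
def δFinv : SmoothFn d M → SmoothFn d M := Function.invFunOn Φ.δF Φ.dom

theorem δF_δFinv (f : SmoothFn d M) : Φ.δF (Φ.δFinv f) = f :=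
  Φ.bijOn_δF.surjOn.rightInvOn_invFunOn (Set.mem_univ f)

theorem δFinv_δF {η : SmoothFn d M} (hη : η ∈ Φ.dom) : Φ.δFinv (Φ.δF η) = η :=
  Φ.bijOn_δF.injOn.leftInvOn_invFunOn hη

/-- The second variation (`L²` Hessian) `δ²F(η)` as an operator:
`v ↦ ∫ δ²F(η)(·, y) v(y) dy`, the derivative of `δF` at `η` in the direction `v`. -/
def secondVariation (η v : SmoothFn d M) : SmoothFn d M :=
  velocity fun t => Φ.δF (η + t • v)

/-- The density `ρ = (δF)⁻¹(δF(η) + δF(η^*))`. -/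
def density (z : SmoothFn d M × SmoothFn d M) : SmoothFn d M :=
  Φ.δFinv (Φ.δF z.1 + Φ.δF z.2)

/-- `σ(η, η^*) = -½ [δ²F(η)]⁻¹ δ²F(ρ) [δ²F(η^*)]⁻¹`. -/
def sigma (z : SmoothFn d M × SmoothFn d M) (α : SmoothFn d M) : SmoothFn d M :=
  (-(1 / 2) : ℝ) • Function.invFun (Φ.secondVariation z.1)
    (Φ.secondVariation (Φ.density z) (Function.invFun (Φ.secondVariation z.2) α))

/-- The space of Hopf–Cole variables
`η = (δF)⁻¹(½(δF(ρ) + S))`, `η^* = (δF)⁻¹(½(δF(ρ) - S))` with `(ρ, S) ∈ T^*P(M)`.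
As `S` is given up to an additive constant, `(δF(η), δF(η^*))` is given up to
`(δF(η) + k, δF(η^*) - k)`. -/
def hopfColeSpace : PhaseSpace d M where
  carrier := {z | ∃ ρ ∈ densities μ, ∃ S : SmoothFn d M,
    z.1 = Φ.δFinv ((1 / 2 : ℝ) • (Φ.δF ρ + S)) ∧ z.2 = Φ.δFinv ((1 / 2 : ℝ) • (Φ.δF ρ - S))}
  rel :=
    { r := fun z z' => ∃ k : ℝ, ∀ x,
        Φ.δF z'.1.1 x = Φ.δF z.1.1 x + k ∧ Φ.δF z'.1.2 x = Φ.δF z.1.2 x - k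
      iseqv :=
        { refl := fun z => ⟨0, fun x => ⟨(add_zero _).symm, (sub_zero _).symm⟩⟩
          symm := fun {z z'} h => by
            obtain ⟨k, h⟩ := h
            exact ⟨-k, fun x => ⟨by rw [(h x).1]; ring, by rw [(h x).2]; ring⟩⟩
          trans := fun {z z' z''} h h' => by
            obtain ⟨k, h⟩ := h
            obtain ⟨k', h'⟩ := h'
            exact ⟨k + k', fun x => ⟨by rw [(h' x).1, (h x).1]; ring,
              by rw [(h' x).2, (h x).2]; ring⟩⟩ } }

/-- The 2-form `∫ (σ(η, η^*)⁻¹ η̇₁) η̇₂^* - (σ(η, η^*)⁻¹ η̇₂) η̇₁^* dx` on Hopf–Cole variables: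
the form whose Hamiltonian flows are `∂ₜη = σ ∂K/∂η^*`, `∂ₜη^* = -σ^T ∂K/∂η`. -/
def hopfColeForm (z : Φ.hopfColeSpace.carrier) (v w : SmoothFn d M × SmoothFn d M) : ℝ :=
  ∫ x, (Function.invFun (Φ.sigma z.1) v.1 x * w.2 x -
    Function.invFun (Φ.sigma z.1) w.1 x * v.2 x) ∂μ

theorem density_mem (z : Φ.hopfColeSpace.carrier) :
    Φ.density z.1 ∈ densities μ := by
  obtain ⟨z, ρ, hρ, S, h₁, h₂⟩ := z
  have h : Φ.δF z.1 + Φ.δF z.2 = Φ.δF ρ := by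
    rw [h₁, h₂, δF_δFinv, δF_δFinv, ← smul_add]
    rw [show Φ.δF ρ + S + (Φ.δF ρ - S) = (2 : ℝ) • Φ.δF ρ by rw [two_smul]; abel, smul_smul]
    norm_num
  change Φ.density z ∈ densities μ
  rw [density, h, δFinv_δF Φ (Φ.densities_subset hρ)]
  exact hρ

/-- The generalized Hopf–Cole transformation `(η, η^*) ↦ (ρ, S)`, with
`δF(ρ) = δF(η) + δF(η^*)` and `S = δF(η) - δF(η^*)`. -/
def hopfCole (z : Φ.hopfColeSpace.carrier) : (cotangentBundle (d := d) μ).carrier :=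
  ⟨(Φ.density z.1, Φ.δF z.1.1 - Φ.δF z.1.2), Φ.density_mem z⟩

end InvertiblePotential

end

end HopfCole

end

/-! Write `f = δF(η)` and `g = δF(η^*)`. In these variables the transformation is linear, `δF(ρ) = f
+ g` and `S = f - g`, with inverse given by half sums and half differences. Since `δF` and its
inverse are smooth, it is a diffeomorphism already on representatives. The ambiguity `(f + k, g -
k)` fixes `ρ` and shifts `S` by `2k`, so it corresponds exactly to the constants in `S`.

For the forms, let `A`, `B`, `R` be the second variations at `η`, `η^*`, `ρ`, and let `aᵢ = A η̇ᵢ`,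
`bᵢ = B η̇ᵢ^*`. The chain rule gives `ρ̇ᵢ = R⁻¹(aᵢ + bᵢ)` and `Ṡᵢ = aᵢ - bᵢ`. In the canonical form
the `a₁a₂` and `b₁b₂` terms cancel because `R⁻¹` is symmetric, which leaves `-2⟨R⁻¹a₁, b₂⟩ +
2⟨R⁻¹a₂, b₁⟩`. As `σ⁻¹ = -2 B R⁻¹ A` and `B` is symmetric, this is the Hopf–Cole form
(`wassersteinForm_vel_hopfCole`). Symmetry is Schwarz's theorem for `F(η + s v + t w)`
(`pairing_secondVariation`); invertibility comes from differentiating `δF ∘ δF⁻¹ = id` and `δF⁻¹ ∘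
δF = id`.

The canonical form is closed because second derivatives commute, and non-degenerate because of the
test vectors `(0, ρ̇)` and `(Ṡ - mean, 0)`. The Hopf–Cole form inherits both properties by
pull-back.

Smoothness is only tested on finite-dimensional families, so the calculus has to be built from them.
Two-parameter families give additivity of directional derivatives, and with Hadamard's lemma `c(t) =
c(0) + t w(t)` they give the chain rule (`GermSmooth.hasVelocity_comp`). -/

namespace HopfCole

/-! ### Integrals over a compact set depending smoothly on parameters. -/

section ParametricIntegral

variable {V : Type*} [NormedAddCommGroup V] [NormedSpace ℝ V]
  {E : Type*} [NormedAddCommGroup E] [NormedSpace ℝ E] {H : Type*} [TopologicalSpace H]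
  {I : ModelWithCorners ℝ E H} {N : Type*} [TopologicalSpace N] [ChartedSpace H N]

theorem contDiff_slice {f : V × N → ℝ} (hf : ContMDiff (𝓘(ℝ, V).prod I) 𝓘(ℝ, ℝ) ∞ f) (x : N) :
    ContDiff ℝ ∞ fun u => f (u, x) :=
  (hf.comp (contMDiff_id.prodMk contMDiff_const)).contDiff

/-- The derivative of a smooth family in the direction of the parameters is a smooth family. -/
theorem contMDiff_fderiv_slice [IsManifold I ∞ N] {f : V × N → ℝ}
    (hf : ContMDiff (𝓘(ℝ, V).prod I) 𝓘(ℝ, ℝ) ∞ f) :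
    ContMDiff (𝓘(ℝ, V).prod I) 𝓘(ℝ, V →L[ℝ] ℝ) ∞
      fun z : V × N => fderiv ℝ (fun u => f (u, z.2)) z.1 := by
  intro z₀
  have : IsManifold I 1 N := .of_le (n := ∞) (by norm_cast)
  have h := ContMDiffAt.mfderiv (x₀ := z₀) (J := 𝓘(ℝ, V).prod I) (I := 𝓘(ℝ, V)) (I' := 𝓘(ℝ, ℝ))
    (n := ∞) (m := ∞) (fun (z : V × N) (u : V) => f (u, z.2)) (fun z => z.1)
    (by
      apply ContMDiff.contMDiffAt
      exact hf.comp (contMDiff_snd.prodMk (contMDiff_snd.comp contMDiff_fst)))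
    contMDiffAt_fst (by simp)
  refine h.congr_of_eventuallyEq (.of_forall fun z => ?_)
  refine Eq.trans (mfderiv_eq_fderiv (f := fun u => f (u, z.2))).symm ?_
  exact (congrFun (inTangentCoordinates_model_space (I := 𝓘(ℝ, V)) (I' := 𝓘(ℝ, ℝ))
    (fun z : V × N => z.1) (fun z => f (z.1, z.2))
    (fun z => mfderiv 𝓘(ℝ, V) 𝓘(ℝ, ℝ) (fun u => f (u, z.2)) z.1) z₀) z).symm

theorem contMDiff_fderiv_slice_apply [IsManifold I ∞ N] {f : V × N → ℝ}
    (hf : ContMDiff (𝓘(ℝ, V).prod I) 𝓘(ℝ, ℝ) ∞ f) (a : V) :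
    ContMDiff (𝓘(ℝ, V).prod I) 𝓘(ℝ, ℝ) ∞
      fun z : V × N => fderiv ℝ (fun u => f (u, z.2)) z.1 a :=
  (contMDiff_fderiv_slice hf).clm_apply contMDiff_const

variable [FiniteDimensional ℝ V] [IsManifold I ∞ N] [MeasurableSpace N] [OpensMeasurableSpace N]
  {μ : Measure N} [IsFiniteMeasureOnCompacts μ] {K : Set N}

/-- Dominated differentiation: the parameter derivative is jointly continuous, hence bounded on the
compact product of a closed unit ball with `K`. -/
theorem hasFDerivAt_integral_slice (hK : IsCompact K) (hKm : MeasurableSet K) {f : V × N → ℝ}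
    (hf : ContMDiff (𝓘(ℝ, V).prod I) 𝓘(ℝ, ℝ) ∞ f) (u : V) :
    HasFDerivAt (fun u => ∫ x in K, f (u, x) ∂μ)
      (∫ x in K, fderiv ℝ (fun u => f (u, x)) u ∂μ) u := by
  have hc := (contMDiff_fderiv_slice hf).continuous
  obtain ⟨C, hC⟩ := (((isCompact_closedBall u 1).prod hK).bddAbove_image hc.norm.continuousOn)
  have hslice (v : V) : Continuous fun x => f (v, x) :=
    hf.continuous.comp (Continuous.prodMk_right v)
  refine hasFDerivAt_integral_of_dominated_of_fderiv_le (𝕜 := ℝ) (bound := fun _ => C)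
    (F' := fun u x => fderiv ℝ (fun u => f (u, x)) u) (Metric.closedBall_mem_nhds u one_pos)
    (.of_forall fun v => (hslice v).aestronglyMeasurable)
    ((hslice u).continuousOn.integrableOn_compact' hK hKm)
    (hc.comp (Continuous.prodMk_right u)).aestronglyMeasurable ?_
    (integrableOn_const hK.measure_ne_top) ?_
  · refine (ae_restrict_iff' hKm).2 (.of_forall fun x hx v hv => ?_)
    exact hC ⟨(v, x), ⟨hv, hx⟩, rfl⟩
  · refine .of_forall fun x v _ => ?_
    exact ((contDiff_slice hf x).differentiable (by simp) v).hasFDerivAt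

theorem fderiv_integral_slice_apply (hK : IsCompact K) (hKm : MeasurableSet K) {f : V × N → ℝ}
    (hf : ContMDiff (𝓘(ℝ, V).prod I) 𝓘(ℝ, ℝ) ∞ f) (u a : V) :
    fderiv ℝ (fun u => ∫ x in K, f (u, x) ∂μ) u a =
      ∫ x in K, fderiv ℝ (fun u => f (u, x)) u a ∂μ := by
  rw [(hasFDerivAt_integral_slice hK hKm hf u).fderiv]
  refine ContinuousLinearMap.integral_apply ?_ a
  exact ((contMDiff_fderiv_slice hf).continuous.comp
    (Continuous.prodMk_right u)).continuousOn.integrableOn_compact' hK hKm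

/-- Induction on the order: each directional derivative is again the integral of a smooth family,
and in finite dimension directional derivatives detect `C^n`. -/
theorem contDiff_integral_slice (hK : IsCompact K) (hKm : MeasurableSet K) {f : V × N → ℝ}
    (hf : ContMDiff (𝓘(ℝ, V).prod I) 𝓘(ℝ, ℝ) ∞ f) :
    ContDiff ℝ ∞ fun u => ∫ x in K, f (u, x) ∂μ := by
  rw [contDiff_infty]
  intro n
  induction n generalizing f with
  | zero =>
    exact contDiff_zero.2 <| continuous_iff_continuousAt.2 fun u =>
      (hasFDerivAt_integral_slice hK hKm hf u).continuousAt
  | succ n ih =>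
    push_cast
    rw [contDiff_succ_iff_fderiv_apply]
    refine ⟨fun u => (hasFDerivAt_integral_slice hK hKm hf u).differentiableAt, by simp,
      fun a => ?_⟩
    simp only [fderiv_integral_slice_apply hK hKm hf]
    exact ih (contMDiff_fderiv_slice_apply hf a)

end ParametricIntegral

/-! ### Hadamard's lemma with parameters in a manifold. -/

section Hadamard

variable {E : Type*} [NormedAddCommGroup E] [NormedSpace ℝ E] [FiniteDimensional ℝ E]
  {H : Type*} [TopologicalSpace H]
  {I : ModelWithCorners ℝ E H} [I.Boundaryless] {N : Type*} [TopologicalSpace N] [ChartedSpace H N]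
  [IsManifold I ∞ N]

theorem contMDiff_integral_Icc {f : N × ℝ → ℝ}
    (hf : ContMDiff (I.prod 𝓘(ℝ, ℝ)) 𝓘(ℝ, ℝ) ∞ f) :
    ContMDiff I 𝓘(ℝ, ℝ) ∞ fun x => ∫ s in Set.Icc (0 : ℝ) 1, f (x, s) := by
  intro x₀
  set φ := extChartAt I x₀
  have ho : IsOpen φ.target := isOpen_extChartAt_target x₀
  have hx₀ : φ x₀ ∈ φ.target := mem_extChartAt_target x₀
  obtain ⟨ε, hε, hball⟩ := Metric.isOpen_iff.1 ho _ hx₀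
  -- The claim is local in `x₀`. Multiplying by a bump supported in the chart target extends the
  -- integrand by zero to the whole model space, where the result for normed parameter spaces
  -- applies.
  let χ : ContDiffBump (φ x₀) := ⟨ε / 4, ε / 2, by positivity, by linarith⟩
  have hχ : tsupport χ ⊆ φ.target := by
    rw [χ.tsupport_eq]
    exact (Metric.closedBall_subset_ball (by change ε / 2 < ε; linarith)).trans hball
  let g : E × ℝ → ℝ := fun z => χ z.1 * f (φ.symm z.1, z.2)
  have hg : ContMDiff (𝓘(ℝ, E).prod 𝓘(ℝ, ℝ)) 𝓘(ℝ, ℝ) ∞ g := by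
    intro z
    by_cases hz : z.1 ∈ φ.target
    · refine ContMDiffAt.mul (χ.contDiff.contMDiff.contMDiffAt.comp z contMDiffAt_fst) ?_
      refine hf.contMDiffAt.comp z (ContMDiffAt.prodMk ?_ contMDiffAt_snd)
      exact ((contMDiffOn_extChartAt_symm x₀).contMDiffAt (ho.mem_nhds hz)).comp z contMDiffAt_fst
    · refine (contMDiffAt_const (c := (0 : ℝ))).congr_of_eventuallyEq ?_
      have h1 : ∀ᶠ y in 𝓝 z.1, χ y = 0 :=
        notMem_tsupport_iff_eventuallyEq.1 fun h => hz (hχ h)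
      filter_upwards [continuous_fst.continuousAt.eventually h1] with y hy
      simp [g, hy]
  have hG := contDiff_integral_slice (μ := volume) isCompact_Icc
    (measurableSet_Icc (a := (0 : ℝ)) (b := 1)) hg
  refine (hG.contMDiff.contMDiffAt.comp x₀ (contMDiffAt_extChartAt (I := I))).congr_of_eventuallyEq
    ?_
  have h1 : ∀ᶠ x in 𝓝 x₀, χ (φ x) = 1 :=
    (continuousAt_extChartAt x₀).eventually χ.eventuallyEq_one
  filter_upwards [h1, extChartAt_source_mem_nhds (I := I) x₀] with x hx hxs
  simp only [g, Function.comp, φ.left_inv hxs, hx, one_mul, φ] at *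

/-- Hadamard's lemma with parameters in a manifold. -/
theorem exists_contMDiff_sub_eq_mul {f : ℝ × N → ℝ}
    (hf : ContMDiff (𝓘(ℝ, ℝ).prod I) 𝓘(ℝ, ℝ) ∞ f) :
    ∃ g : ℝ × N → ℝ, ContMDiff (𝓘(ℝ, ℝ).prod I) 𝓘(ℝ, ℝ) ∞ g ∧
      ∀ t x, f (t, x) = f (0, x) + t * g (t, x) := by
  -- The fundamental theorem of calculus for `s ↦ f(s t, x)` on `[0, 1]`.
  refine ⟨fun z => ∫ s in Set.Icc (0 : ℝ) 1, fderiv ℝ (fun t => f (t, z.2)) (s * z.1) 1, ?_, ?_⟩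
  · refine contMDiff_integral_Icc
      (f := fun w : (ℝ × N) × ℝ => fderiv ℝ (fun t => f (t, w.1.2)) (w.2 * w.1.1) 1) ?_
    have h₁ : ContMDiff ((𝓘(ℝ, ℝ).prod I).prod 𝓘(ℝ, ℝ)) 𝓘(ℝ, ℝ) ∞
        fun w : (ℝ × N) × ℝ => w.2 * w.1.1 :=
      contMDiff_snd.mul (contMDiff_fst.comp contMDiff_fst)
    have h₂ : ContMDiff ((𝓘(ℝ, ℝ).prod I).prod 𝓘(ℝ, ℝ)) I ∞ fun w : (ℝ × N) × ℝ => w.1.2 :=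
      contMDiff_snd.comp contMDiff_fst
    exact (contMDiff_fderiv_slice_apply hf 1).comp (h₁.prodMk h₂)
  · intro t x
    have hd := contDiff_slice hf x
    have hder (s : ℝ) : HasDerivAt (fun s : ℝ => f (s * t, x))
        (t * fderiv ℝ (fun t => f (t, x)) (s * t) 1) s := by
      have h := ((hd.differentiable (by simp)) (s * t)).hasFDerivAt.comp_hasDerivAt s
        ((hasDerivAt_id s).mul_const t)
      rw [← smul_eq_mul, ← map_smul, smul_eq_mul, mul_one]
      rwa [one_mul] at h
    have hcont : Continuous fun s : ℝ => t * fderiv ℝ (fun t => f (t, x)) (s * t) 1 := by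
      have := hd.continuous_fderiv (by simp)
      fun_prop
    have := intervalIntegral.integral_eq_sub_of_hasDerivAt (a := 0) (b := 1)
      (fun s _ => hder s) (hcont.intervalIntegrable _ _)
    rw [intervalIntegral.integral_const_mul, intervalIntegral.integral_of_le zero_le_one,
      ← integral_Icc_eq_integral_Ioc] at this
    simp only [one_mul, zero_mul] at this
    simp only [this]
    ring

end Hadamard

/-! ### Smooth families of functions and their relation to plots. -/

section SmoothFamily

variable {d : ℕ} {M : Type*} [TopologicalSpace M] [ChartedSpace (EuclideanSpace ℝ (Fin d)) M]
  {V W : Type*} [NormedAddCommGroup V] [NormedSpace ℝ V] [NormedAddCommGroup W] [NormedSpace ℝ W]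

/-- A family of smooth functions with parameters in a normed space which is jointly smooth. -/
def SmoothFamily (p : V → SmoothFn d M) : Prop :=
  ContMDiff (𝓘(ℝ, V).prod (𝓡 d)) 𝓘(ℝ, ℝ) ∞ fun z : V × M => p z.1 z.2

namespace SmoothFamily

theorem const (f : SmoothFn d M) : SmoothFamily fun _ : V => f :=
  f.contMDiff.comp contMDiff_snd

theorem comp {p : V → SmoothFn d M} (hp : SmoothFamily p) {φ : W → V} (hφ : ContDiff ℝ ∞ φ) :
    SmoothFamily fun w => p (φ w) :=
  ContMDiff.comp (g := fun z : V × M => p z.1 z.2) (f := fun z : W × M => (φ z.1, z.2)) hp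
    ((hφ.contMDiff.comp contMDiff_fst).prodMk contMDiff_snd)

theorem add {p q : V → SmoothFn d M} (hp : SmoothFamily p) (hq : SmoothFamily q) :
    SmoothFamily fun u => p u + q u :=
  ContMDiff.add hp hq

theorem sub {p q : V → SmoothFn d M} (hp : SmoothFamily p) (hq : SmoothFamily q) :
    SmoothFamily fun u => p u - q u :=
  ContMDiff.sub hp hq

theorem mul {p q : V → SmoothFn d M} (hp : SmoothFamily p) (hq : SmoothFamily q) :
    SmoothFamily fun u => p u * q u :=
  ContMDiff.mul hp hq

theorem smul {p : V → SmoothFn d M} (hp : SmoothFamily p) {φ : V → ℝ} (hφ : ContDiff ℝ ∞ φ) :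
    SmoothFamily fun u => φ u • p u :=
  ContMDiff.mul (f := fun z : V × M => φ z.1) (hφ.contMDiff.comp contMDiff_fst) hp

theorem contDiff_apply {p : V → SmoothFn d M} (hp : SmoothFamily p) (x : M) :
    ContDiff ℝ ∞ fun u => p u x :=
  contDiff_slice hp x

theorem differentiableAt_apply {p : V → SmoothFn d M} (hp : SmoothFamily p) (x : M) (u : V) :
    DifferentiableAt ℝ (fun u => p u x) u :=
  (hp.contDiff_apply x).differentiable (by simp) u

/-- Reduction of a statement on plots to arbitrary finite-dimensional parameter spaces. -/
theorem of_comp_toEuclidean_symm [FiniteDimensional ℝ V] {p : V → SmoothFn d M}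
    (hp : SmoothFamily fun u => p ((toEuclidean (E := V)).symm u)) : SmoothFamily p := by
  simpa using hp.comp (toEuclidean (E := V)).contDiff

theorem map [FiniteDimensional ℝ V] {D : Set (SmoothFn d M)} {G : SmoothFn d M → SmoothFn d M}
    (hG : DSmooth fun η : D => G η) {p : V → SmoothFn d M} (hp : SmoothFamily p)
    (hD : ∀ u, p u ∈ D) : SmoothFamily fun u => G (p u) :=
  of_comp_toEuclidean_symm <|
    hG _ (fun u => ⟨p ((toEuclidean (E := V)).symm u), hD _⟩)
      (hp.comp (toEuclidean (E := V)).symm.contDiff)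

variable [IsManifold (𝓡 d) ∞ M]

/-- The derivative of a smooth family in the direction `a`. -/
noncomputable def lineDeriv {p : V → SmoothFn d M} (hp : SmoothFamily p) (a u : V) : SmoothFn d M :=
  ⟨fun x => fderiv ℝ (fun u => p u x) u a,
    ContMDiff.comp (contMDiff_fderiv_slice_apply hp a) (contMDiff_const.prodMk contMDiff_id)⟩

theorem lineDeriv_apply {p : V → SmoothFn d M} (hp : SmoothFamily p) (a u : V) (x : M) :
    hp.lineDeriv a u x = fderiv ℝ (fun u => p u x) u a :=
  rfl

theorem smoothFamily_lineDeriv {p : V → SmoothFn d M} (hp : SmoothFamily p) (a : V) :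
    SmoothFamily (hp.lineDeriv a) :=
  contMDiff_fderiv_slice_apply hp a

theorem exists_eq_add_smul {c : ℝ → SmoothFn d M} (hc : SmoothFamily c) :
    ∃ w : ℝ → SmoothFn d M, SmoothFamily w ∧ ∀ t, c t = c 0 + t • w t := by
  obtain ⟨g, hg, h⟩ := exists_contMDiff_sub_eq_mul hc
  refine ⟨fun t => ⟨fun x => g (t, x), hg.comp (contMDiff_const.prodMk contMDiff_id)⟩, hg, ?_⟩
  intro t
  ext x
  exact h t x

end SmoothFamily

theorem dSmooth_iff_smoothFamily {c : ℝ → SmoothFn d M} : DSmooth c ↔ SmoothFamily c :=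
  ⟨fun hc => .of_comp_toEuclidean_symm (hc _ _ (toEuclidean (E := ℝ)).symm.contDiff.isPlot),
    fun hc _ _ hp => hc.comp hp.contDiff⟩

theorem dSmooth_subtype_iff {X Z : Type*} [DiffeologicalSpace X] [DiffeologicalSpace Z]
    {P : Z → Prop} {f : X → Subtype P} : DSmooth f ↔ DSmooth fun u => (f u : Z) :=
  Iff.rfl

theorem dSmooth_prod_iff {X Y Z : Type*} [DiffeologicalSpace X] [DiffeologicalSpace Y]
    [DiffeologicalSpace Z] {f : X → Y × Z} :
    DSmooth f ↔ (DSmooth fun u => (f u).1) ∧ DSmooth fun u => (f u).2 :=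
  ⟨fun h => ⟨fun n p hp => (h n p hp).1, fun n p hp => (h n p hp).2⟩,
    fun h n p hp => ⟨h.1 n p hp, h.2 n p hp⟩⟩

end SmoothFamily

/-! ### Velocities, directional derivatives and the chain rule on `C^∞(M)`. -/

section Velocity

variable {d : ℕ} {M : Type*} [TopologicalSpace M] [ChartedSpace (EuclideanSpace ℝ (Fin d)) M]

/-- `w` is the velocity of the curve `c` at `t = 0`. -/
def HasVelocity (c : ℝ → SmoothFn d M) (w : SmoothFn d M) : Prop :=
  ∀ x, HasDerivAt (fun t => c t x) (w x) 0

namespace HasVelocity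

variable {c c' : ℝ → SmoothFn d M} {v w : SmoothFn d M}

theorem unique (hv : HasVelocity c v) (hw : HasVelocity c w) : v = w := by
  ext x
  exact (hv x).unique (hw x)

theorem velocity_eq (hw : HasVelocity c w) : velocity c = w := by
  have h : ∃ w : SmoothFn d M, ∀ x, HasDerivAt (fun t => c t x) (w x) 0 := ⟨w, hw⟩
  rw [velocity, dif_pos h]
  exact unique (c := c) h.choose_spec hw

theorem congr (hw : HasVelocity c w) (h : c' =ᶠ[𝓝 0] c) : HasVelocity c' w := fun x =>
  (hw x).congr_of_eventuallyEq (h.mono fun t ht => by simp only [ht])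

theorem add (hv : HasVelocity c v) (hw : HasVelocity c' w) :
    HasVelocity (fun t => c t + c' t) (v + w) := fun x => (hv x).add (hw x)

theorem sub (hv : HasVelocity c v) (hw : HasVelocity c' w) :
    HasVelocity (fun t => c t - c' t) (v - w) := fun x => (hv x).sub (hw x)

theorem const_smul (r : ℝ) (hv : HasVelocity c v) :
    HasVelocity (fun t => r • c t) (r • v) := fun x => (hv x).const_mul r

end HasVelocity

theorem hasVelocity_const (f : SmoothFn d M) : HasVelocity (fun _ => f) 0 :=
  fun x => hasDerivAt_const 0 (f x)

theorem hasVelocity_line (f v : SmoothFn d M) : HasVelocity (fun t => f + t • v) v := fun x => by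
  simpa using ((hasDerivAt_id (0 : ℝ)).mul_const (v x)).const_add (f x)

theorem smoothFamily_line (f v : SmoothFn d M) : SmoothFamily fun t : ℝ => f + t • v :=
  (SmoothFamily.const f).add ((SmoothFamily.const v).smul contDiff_id)

theorem smoothFamily_plane (f v w : SmoothFn d M) :
    SmoothFamily fun z : ℝ × ℝ => f + z.1 • v + z.2 • w :=
  ((SmoothFamily.const f).add ((SmoothFamily.const v).smul contDiff_fst)).add
    ((SmoothFamily.const w).smul contDiff_snd)

/-- `G` maps two-parameter families through `η` to families which are smooth near `0`. -/
def GermSmooth (G : SmoothFn d M → SmoothFn d M) (η : SmoothFn d M) : Prop :=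
  ∀ p : ℝ × ℝ → SmoothFn d M, SmoothFamily p → p 0 = η →
    ∃ q : ℝ × ℝ → SmoothFn d M, SmoothFamily q ∧ (fun z => G (p z)) =ᶠ[𝓝 0] q

/-- The derivative of `G` at `η` in the direction `v`. -/
noncomputable def dirDeriv (G : SmoothFn d M → SmoothFn d M) (η v : SmoothFn d M) : SmoothFn d M :=
  velocity fun t => G (η + t • v)

theorem GermSmooth.exists_curve {G : SmoothFn d M → SmoothFn d M} {η : SmoothFn d M}
    (hG : GermSmooth G η) {c : ℝ → SmoothFn d M} (hc : SmoothFamily c)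
    (h0 : c 0 = η) : ∃ q : ℝ → SmoothFn d M, SmoothFamily q ∧ (fun t => G (c t)) =ᶠ[𝓝 0] q := by
  obtain ⟨q, hq, h⟩ := hG (fun z => c z.1) (hc.comp contDiff_fst) h0
  refine ⟨fun t => q (t, 0), hq.comp (contDiff_id.prodMk contDiff_const), ?_⟩
  have : Filter.Tendsto (fun t : ℝ => ((t, 0) : ℝ × ℝ)) (𝓝 0) (𝓝 0) :=
    Continuous.tendsto' (by fun_prop) _ _ rfl
  exact this.eventually h

theorem SmoothFamily.isOpen_preimage {V : Type*} [NormedAddCommGroup V] [NormedSpace ℝ V]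
    [FiniteDimensional ℝ V] {p : V → SmoothFn d M} (hp : SmoothFamily p) {D : Set (SmoothFn d M)}
    (hD : IsOpen[dTopology] D) : IsOpen (p ⁻¹' D) := by
  have h := (isOpen_iff_preimages_plots.1 hD _ (fun u => p ((toEuclidean (E := V)).symm u))
    (hp.comp (toEuclidean (E := V)).symm.contDiff)).preimage (toEuclidean (E := V)).continuous
  convert h using 1
  ext z
  simp

/-- Smoothness on `D` is tested only on families lying entirely in `D`. Reparametrizing by `z ↦ χ(z)
z` keeps the family inside `D` and changes nothing near `0`. -/
theorem germSmooth_of_dSmooth {D : Set (SmoothFn d M)} (hD : IsOpen[dTopology] D)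
    {G : SmoothFn d M → SmoothFn d M} (hG : DSmooth fun η : D => G η) {η : SmoothFn d M}
    (hη : η ∈ D) : GermSmooth G η := by
  intro p hp h0
  obtain ⟨ε, hε, hball⟩ := Metric.isOpen_iff.1 (hp.isOpen_preimage hD) 0 (by simpa [h0] using hη)
  let χ : ContDiffBump (0 : ℝ × ℝ) := ⟨ε / 4, ε / 2, by positivity, by linarith⟩
  have hχ : ContDiff ℝ ∞ fun z => χ z • z := χ.contDiff.smul contDiff_id
  refine ⟨fun z => G (p (χ z • z)), SmoothFamily.map hG (hp.comp hχ) fun z => ?_, ?_⟩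
  · refine hball ?_
    -- Inside the support radius the factor `χ ≤ 1` only shrinks `z`; outside it the point is `0`.
    by_cases hz : z ∈ Metric.ball (0 : ℝ × ℝ) (ε / 2)
    · rw [mem_ball_zero_iff] at hz ⊢
      rw [norm_smul, Real.norm_of_nonneg χ.nonneg]
      nlinarith [χ.le_one (x := z), χ.nonneg (x := z), norm_nonneg z]
    · rw [χ.zero_of_le_dist (by simpa using hz)]
      simpa using hε
  · filter_upwards [χ.eventuallyEq_one] with z hz
    simp [hz]

variable [IsManifold (𝓡 d) ∞ M]

theorem SmoothFamily.hasVelocity_line {V : Type*} [NormedAddCommGroup V] [NormedSpace ℝ V]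
    {p : V → SmoothFn d M} (hp : SmoothFamily p) (u a : V) :
    HasVelocity (fun t : ℝ => p (u + t • a)) (hp.lineDeriv a u) := fun x => by
  have h := (hp.differentiableAt_apply x u).hasFDerivAt.hasLineDerivAt a
  exact h

theorem SmoothFamily.hasVelocity {c : ℝ → SmoothFn d M} (hc : SmoothFamily c) :
    HasVelocity c (velocity c) := by
  have h := hc.hasVelocity_line 0 1
  simp only [zero_add, smul_eq_mul, mul_one] at h
  rwa [h.velocity_eq]

namespace GermSmooth

variable {G : SmoothFn d M → SmoothFn d M} {η : SmoothFn d M}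

theorem hasVelocity_dirDeriv (hG : GermSmooth G η) (v : SmoothFn d M) :
    HasVelocity (fun t => G (η + t • v)) (dirDeriv G η v) := by
  obtain ⟨q, hq, h⟩ := hG.exists_curve (smoothFamily_line η v) (by simp)
  have hvel := hq.hasVelocity.congr h
  rwa [← hvel.velocity_eq] at hvel

/-- The velocity of `G ∘ p` along the diagonal is the sum of those along the axes. -/
theorem hasVelocity_diag (hG : GermSmooth G η) {p : ℝ × ℝ → SmoothFn d M} (hp : SmoothFamily p)
    (h0 : p 0 = η) {v w : SmoothFn d M} (hv : HasVelocity (fun t => G (p (t, 0))) v)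
    (hw : HasVelocity (fun t => G (p (0, t))) w) : HasVelocity (fun t => G (p (t, t))) (v + w) := by
  obtain ⟨q, hq, h⟩ := hG p hp h0
  have key (a : ℝ × ℝ) : HasVelocity (fun t : ℝ => G (p (t • a))) (hq.lineDeriv a 0) := by
    have h1 := hq.hasVelocity_line 0 a
    simp only [zero_add] at h1
    refine h1.congr ?_
    have : Filter.Tendsto (fun t : ℝ => t • a) (𝓝 0) (𝓝 0) :=
      Continuous.tendsto' (by fun_prop) _ _ (by simp)
    exact this.eventually h
  -- The derivative of `q` at `0` is linear on `ℝ × ℝ`, and `(1, 1) = (1, 0) + (0, 1)`.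
  have h1 := key (1, 0)
  have h2 := key (0, 1)
  have h3 := key (1, 1)
  simp only [Prod.smul_mk, smul_eq_mul, mul_one, mul_zero] at h1 h2 h3
  rw [hv.unique h1, hw.unique h2]
  convert h3 using 1
  ext x
  change hq.lineDeriv _ _ _ + hq.lineDeriv _ _ _ = _
  simp only [SmoothFamily.lineDeriv_apply, ← map_add]
  simp

/-- The chain rule. -/
theorem hasVelocity_comp (hG : GermSmooth G η) {c : ℝ → SmoothFn d M} (hc : SmoothFamily c)
    (h0 : c 0 = η) {v : SmoothFn d M} (hv : HasVelocity c v) :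
    HasVelocity (fun t => G (c t)) (dirDeriv G η v) := by
  obtain ⟨w, hw, h⟩ := hc.exists_eq_add_smul
  have hw0 : w 0 = v := by
    refine HasVelocity.unique (c := c) (fun x => ?_) hv
    -- In the product rule the derivative of `w` is multiplied by `t = 0`.
    have h1 : HasDerivAt (fun t : ℝ => η x + t * w t x)
        (1 * w 0 x + 0 * deriv (fun t => w t x) 0) 0 :=
      ((hasDerivAt_id (0 : ℝ)).mul (hw.differentiableAt_apply x 0).hasDerivAt).const_add _
    simp only [one_mul, zero_mul, add_zero] at h1
    refine h1.congr_of_eventuallyEq (.of_forall fun t => ?_)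
    change c t x = _
    rw [h t, h0]
    rfl
  -- The curve is the diagonal of this family. Along the first axis it is a straight line with
  -- velocity `w 0 = v`; along the second it is constant and contributes nothing.
  have hp : SmoothFamily fun z : ℝ × ℝ => η + z.1 • w z.2 :=
    (SmoothFamily.const η).add ((hw.comp contDiff_snd).smul contDiff_fst)
  have h1 : HasVelocity (fun t => G (η + t • w 0)) (dirDeriv G η v) := by
    rw [hw0]; exact hG.hasVelocity_dirDeriv v
  have h2 : HasVelocity (fun t => G (η + (0 : ℝ) • w t)) 0 := by
    simpa using hasVelocity_const (G η)
  have h3 := hG.hasVelocity_diag hp (by simp) h1 h2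
  rw [add_zero] at h3
  refine h3.congr (.of_forall fun t => ?_)
  simp only [h t, h0]

theorem dirDeriv_add (hG : GermSmooth G η) (v w : SmoothFn d M) :
    dirDeriv G η (v + w) = dirDeriv G η v + dirDeriv G η w := by
  have h := hG.hasVelocity_diag (smoothFamily_plane η v w) (by simp)
    (v := dirDeriv G η v) (w := dirDeriv G η w)
    (by simpa using hG.hasVelocity_dirDeriv v) (by simpa using hG.hasVelocity_dirDeriv w)
  refine (hG.hasVelocity_dirDeriv (v + w)).unique ?_
  simpa only [smul_add, add_assoc] using h

theorem dirDeriv_smul (hG : GermSmooth G η) (r : ℝ) (v : SmoothFn d M) :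
    dirDeriv G η (r • v) = r • dirDeriv G η v := by
  refine (hG.hasVelocity_dirDeriv (r • v)).unique fun x => ?_
  have h := (hG.hasVelocity_dirDeriv v) x
  have h' : HasDerivAt (fun t : ℝ => t * r) r 0 := by
    simpa using (hasDerivAt_id (0 : ℝ)).mul_const r
  have := HasDerivAt.scomp (0 : ℝ) (h := fun t : ℝ => t * r) (h' := r)
    (g₁ := fun t => G (η + t • v) x) (by simpa using h) h'
  simp only [smul_smul]
  exact this

end GermSmooth

end Velocity

/-! ### The `L²` pairing and its differentiation along families. -/

section Pairing

variable {d : ℕ} {M : Type*} [TopologicalSpace M]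
  [ChartedSpace (EuclideanSpace ℝ (Fin d)) M] [MeasurableSpace M] (μ : Measure M)

/-- The `L²` pairing of smooth functions. -/
noncomputable def pairing (f g : SmoothFn d M) : ℝ := ∫ x, f x * g x ∂μ

theorem pairing_comm (f g : SmoothFn d M) : pairing μ f g = pairing μ g f := by
  simp only [pairing, mul_comm]

theorem pairing_smul_left (r : ℝ) (f g : SmoothFn d M) :
    pairing μ (r • f) g = r * pairing μ f g := by
  rw [pairing, pairing, ← integral_const_mul]
  exact integral_congr_ae (.of_forall fun x => mul_assoc r (f x) (g x))

theorem pairing_smul_right (r : ℝ) (f g : SmoothFn d M) :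
    pairing μ f (r • g) = r * pairing μ f g := by
  rw [pairing_comm, pairing_smul_left, pairing_comm]

variable [CompactSpace M] [BorelSpace M] [IsFiniteMeasure μ]

theorem integrable_smoothFn (f : SmoothFn d M) : Integrable f μ :=
  f.contMDiff.continuous.integrable_of_hasCompactSupport (HasCompactSupport.of_compactSpace f)

theorem pairing_add_left (f g h : SmoothFn d M) :
    pairing μ (f + g) h = pairing μ f h + pairing μ g h := by
  refine Eq.trans ?_ (integral_add (integrable_smoothFn μ (f * h)) (integrable_smoothFn μ (g * h)))
  exact integral_congr_ae (.of_forall fun x => add_mul (f x) (g x) (h x))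

theorem pairing_add_right (f g h : SmoothFn d M) :
    pairing μ f (g + h) = pairing μ f g + pairing μ f h := by
  rw [pairing_comm, pairing_add_left, pairing_comm μ g, pairing_comm μ h]

theorem pairing_sub_left (f g h : SmoothFn d M) :
    pairing μ (f - g) h = pairing μ f h - pairing μ g h := by
  rw [sub_eq_add_neg, ← neg_one_smul ℝ g, pairing_add_left, pairing_smul_left]
  ring

theorem pairing_sub_right (f g h : SmoothFn d M) :
    pairing μ f (g - h) = pairing μ f g - pairing μ f h := by
  rw [pairing_comm, pairing_sub_left, pairing_comm μ g, pairing_comm μ h]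

theorem integral_pairing_sub (f g h k : SmoothFn d M) :
    ∫ x, (f x * g x - h x * k x) ∂μ = pairing μ f g - pairing μ h k :=
  integral_sub (integrable_smoothFn μ (f * g)) (integrable_smoothFn μ (h * k))

/-- A continuous non-negative function that is positive somewhere has positive integral, as `μ`
charges open sets. All non-degeneracy rests on this. -/
theorem eq_zero_of_pairing_self [μ.IsOpenPosMeasure] {f : SmoothFn d M}
    (hf : pairing μ f f = 0) : f = 0 := by
  have hc : Continuous fun x => f x * f x :=
    f.contMDiff.continuous.mul f.contMDiff.continuous
  ext x
  by_contra hx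
  exact (integral_pos_of_integrable_nonneg_nonzero (μ := μ) (x := x) hc
    (integrable_smoothFn μ (f * f)) (fun y => mul_self_nonneg (f y))
    (mul_self_ne_zero.2 hx)).ne' hf

variable {V : Type*} [NormedAddCommGroup V] [NormedSpace ℝ V] [FiniteDimensional ℝ V]
  [IsManifold (𝓡 d) ∞ M] {p q : V → SmoothFn d M}

theorem SmoothFamily.contDiff_integral (hp : SmoothFamily p) :
    ContDiff ℝ ∞ fun u => ∫ x, p u x ∂μ := by
  simpa using contDiff_integral_slice (μ := μ) isCompact_univ .univ hp

theorem SmoothFamily.fderiv_integral (hp : SmoothFamily p) (u a : V) :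
    fderiv ℝ (fun u => ∫ x, p u x ∂μ) u a = ∫ x, hp.lineDeriv a u x ∂μ := by
  have h := fderiv_integral_slice_apply (μ := μ) isCompact_univ .univ hp u a
  rwa [Measure.restrict_univ] at h

theorem SmoothFamily.contDiff_pairing (hp : SmoothFamily p) (hq : SmoothFamily q) :
    ContDiff ℝ ∞ fun u => pairing μ (p u) (q u) :=
  (hp.mul hq).contDiff_integral μ

theorem SmoothFamily.fderiv_pairing (hp : SmoothFamily p) (hq : SmoothFamily q) (u a : V) :
    fderiv ℝ (fun u => pairing μ (p u) (q u)) u a =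
      pairing μ (hp.lineDeriv a u) (q u) + pairing μ (p u) (hq.lineDeriv a u) := by
  refine ((hp.mul hq).fderiv_integral μ u a).trans ?_
  refine Eq.trans ?_ (integral_add (integrable_smoothFn μ (hp.lineDeriv a u * q u))
    (integrable_smoothFn μ (p u * hq.lineDeriv a u)))
  refine integral_congr_ae (.of_forall fun x => ?_)
  have := fderiv_fun_mul (hp.differentiableAt_apply x u) (hq.differentiableAt_apply x u)
  change fderiv ℝ (fun u => p u x * q u x) u a = _
  rw [this]
  simp [SmoothFamily.lineDeriv_apply]
  ring

end Pairing

/-! ### The second variation: invertibility and symmetry. -/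

namespace InvertiblePotential

variable {d : ℕ} {M : Type*} [TopologicalSpace M]
  [ChartedSpace (EuclideanSpace ℝ (Fin d)) M] [MeasurableSpace M]
  {μ : Measure M} (Φ : InvertiblePotential d μ)

theorem δFinv_mem (f : SmoothFn d M) : Φ.δFinv f ∈ Φ.dom :=
  Φ.bijOn_δF.surjOn.mapsTo_invFunOn (Set.mem_univ f)

theorem germSmooth_δF {η : SmoothFn d M} (hη : η ∈ Φ.dom) : GermSmooth Φ.δF η :=
  germSmooth_of_dSmooth Φ.isOpen_dom Φ.smooth_δF hη

theorem smoothFamily_δFinv {V : Type*} [NormedAddCommGroup V] [NormedSpace ℝ V]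
    [FiniteDimensional ℝ V] {p : V → SmoothFn d M} (hp : SmoothFamily p) :
    SmoothFamily fun u => Φ.δFinv (p u) :=
  SmoothFamily.map (D := Set.univ) (G := Φ.δFinv)
    (fun n p hp => Φ.smooth_inv n (fun u => p u) hp) hp
    fun _ => Set.mem_univ _

theorem smoothFamily_δF {V : Type*} [NormedAddCommGroup V] [NormedSpace ℝ V]
    [FiniteDimensional ℝ V] {p : V → SmoothFn d M} (hp : SmoothFamily p)
    (hD : ∀ u, p u ∈ Φ.dom) : SmoothFamily fun u => Φ.δF (p u) :=
  SmoothFamily.map Φ.smooth_δF hp hD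

theorem germSmooth_δFinv (f : SmoothFn d M) : GermSmooth Φ.δFinv f :=
  fun _ hp _ => ⟨_, Φ.smoothFamily_δFinv hp, .rfl⟩

variable [IsManifold (𝓡 d) ∞ M]

/-- Differentiate `δF(δF⁻¹(f + t w)) = f + t w` at `t = 0`. -/
theorem secondVariation_dirDeriv_δFinv (f w : SmoothFn d M) :
    Φ.secondVariation (Φ.δFinv f) (dirDeriv Φ.δFinv f w) = w := by
  refine HasVelocity.unique ((Φ.germSmooth_δF (Φ.δFinv_mem f)).hasVelocity_comp
    (Φ.smoothFamily_δFinv (smoothFamily_line f w)) (by simp)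
    ((Φ.germSmooth_δFinv f).hasVelocity_dirDeriv w)) ?_
  simpa only [δF_δFinv] using hasVelocity_line f w

theorem dirDeriv_δFinv_secondVariation {η : SmoothFn d M} (hη : η ∈ Φ.dom) (v : SmoothFn d M) :
    dirDeriv Φ.δFinv (Φ.δF η) (Φ.secondVariation η v) = v := by
  -- The line `η + t v` may leave `dom`, so `δF` along it is replaced by a globally smooth curve `q`
  -- agreeing with it near `0`. Openness of `dom` gives `δF⁻¹(q t) = η + t v` there.
  obtain ⟨q, hq, h⟩ := (Φ.germSmooth_δF hη).exists_curve (smoothFamily_line η v) (by simp)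
  have hv := (Φ.germSmooth_δF hη).hasVelocity_dirDeriv v
  have h0 : q 0 = Φ.δF η := by simpa using h.self_of_nhds.symm
  refine HasVelocity.unique ((Φ.germSmooth_δFinv _).hasVelocity_comp hq h0 (hv.congr h.symm)) ?_
  refine (hasVelocity_line η v).congr ?_
  have hmem : ∀ᶠ t : ℝ in 𝓝 0, η + t • v ∈ Φ.dom :=
    ((smoothFamily_line η v).isOpen_preimage Φ.isOpen_dom).mem_nhds (by simpa using hη)
  filter_upwards [h, hmem] with t ht hm
  rw [← ht, δFinv_δF Φ hm]

theorem bijective_secondVariation {η : SmoothFn d M} (hη : η ∈ Φ.dom) :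
    Function.Bijective (Φ.secondVariation η) := by
  refine ⟨Function.LeftInverse.injective (Φ.dirDeriv_δFinv_secondVariation hη), fun w =>
    ⟨dirDeriv Φ.δFinv (Φ.δF η) w, ?_⟩⟩
  simpa only [δFinv_δF Φ hη] using Φ.secondVariation_dirDeriv_δFinv (Φ.δF η) w

/-- `Function.invFun` is a genuine inverse only because of bijectivity; it is then the derivative of
`δF⁻¹`, which is available for the chain rule. -/
theorem invFun_secondVariation {η : SmoothFn d M} (hη : η ∈ Φ.dom) :
    Function.invFun (Φ.secondVariation η) = dirDeriv Φ.δFinv (Φ.δF η) := by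
  funext w
  apply (Φ.bijective_secondVariation hη).injective
  rw [Function.rightInverse_invFun (Φ.bijective_secondVariation hη).surjective w]
  simpa only [δFinv_δF Φ hη] using (Φ.secondVariation_dirDeriv_δFinv (Φ.δF η) w).symm

/-- The second variation is symmetric for the `L²` pairing. -/
theorem pairing_secondVariation [CompactSpace M] [BorelSpace M] [IsFiniteMeasure μ]
    {η : SmoothFn d M} (hη : η ∈ Φ.dom) (v w : SmoothFn d M) :
    pairing μ (Φ.secondVariation η v) w = pairing μ v (Φ.secondVariation η w) := by
  have hp := smoothFamily_plane η v w
  have hη' : η + (0 : ℝ × ℝ).1 • v + (0 : ℝ × ℝ).2 • w = η := by simp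
  obtain ⟨q, hq, h⟩ := Φ.germSmooth_δF hη _ hp hη'
  have hmem : ∀ᶠ z : ℝ × ℝ in 𝓝 0, η + z.1 • v + z.2 • w ∈ Φ.dom :=
    (hp.isOpen_preimage Φ.isOpen_dom).mem_nhds (by simpa using hη)
  -- Near `0` this is the derivative of `F` in the direction `g` at `η + z.1 • v + z.2 • w`. Using
  -- `q` in place of `δF` makes it smooth on all of `ℝ × ℝ`.
  let I : SmoothFn d M → ℝ × ℝ → ℝ := fun g z => pairing μ (q z) g
  have hI (g : SmoothFn d M) : ContDiff ℝ ∞ (I g) := hq.contDiff_pairing μ (.const g)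
  have hI' (g : SmoothFn d M) (a : ℝ × ℝ) :
      fderiv ℝ (I g) 0 a = pairing μ (hq.lineDeriv a 0) g := by
    refine (hq.fderiv_pairing μ (.const g) 0 a).trans ?_
    have : (SmoothFamily.const g).lineDeriv a (0 : ℝ × ℝ) = 0 := by
      ext x
      simp [SmoothFamily.lineDeriv_apply]
    rw [this]
    simp [pairing]
  have hvar : ∀ᶠ z : ℝ × ℝ in 𝓝 0, ∀ g : SmoothFn d M,
      HasDerivAt (fun t : ℝ => Φ.F (η + z.1 • v + z.2 • w + t • g)) (I g z) 0 := by
    filter_upwards [hmem, h] with z hz hqz g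
    simpa only [I, ← hqz, pairing] using Φ.isFirstVariation _ hz g
  let f : ℝ → ℝ → ℝ := fun s t => Φ.F (η + s • v + t • w)
  let f' : ℝ × ℝ → ℝ × ℝ →L[ℝ] ℝ := fun z =>
    I v z • ContinuousLinearMap.fst ℝ ℝ ℝ + I w z • ContinuousLinearMap.snd ℝ ℝ ℝ
  -- `F` is only known to be differentiable along lines. Both partial derivatives exist near `0` and
  -- are continuous, which yields Fréchet differentiability in the two real variables.
  have hf : ∀ᶠ z in 𝓝 0, HasFDerivAt (Function.uncurry f) (f' z) z := by
    filter_upwards [eventually_eventually_nhds.2 hvar] with z hz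
    have h1 : ∀ᶠ y in 𝓝 z, HasFDerivAt (fun s => f s y.2)
        (ContinuousLinearMap.toSpanSingleton ℝ (I v y)) y.1 := by
      filter_upwards [hz] with y hy
      have hy' := hy v
      rw [← sub_self y.1] at hy'
      have := hy'.comp_sub_const y.1 y.1
      refine (this.congr_of_eventuallyEq (.of_forall fun s => ?_)).hasFDerivAt
      simp only [f]
      congr 1
      rw [sub_smul]
      abel
    have h2 : ∀ᶠ y in 𝓝 z, HasFDerivAt (fun t => f y.1 t)
        (ContinuousLinearMap.toSpanSingleton ℝ (I w y)) y.2 := by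
      filter_upwards [hz] with y hy
      have hy' := hy w
      rw [← sub_self y.2] at hy'
      have := hy'.comp_sub_const y.2 y.2
      refine (this.congr_of_eventuallyEq (.of_forall fun s => ?_)).hasFDerivAt
      simp only [f]
      congr 1
      rw [sub_smul]
      abel
    have hc (g : SmoothFn d M) :
        Continuous fun y => ContinuousLinearMap.toSpanSingleton ℝ (I g y) :=
      (ContinuousLinearMap.toSpanSingletonCLE (𝕜 := ℝ) (E := ℝ)).continuous.comp (hI g).continuous
    have := (hasStrictFDerivAt_uncurry_coprod (f := f) (u := z)
      (f₁ := fun s t => ContinuousLinearMap.toSpanSingleton ℝ (I v (s, t)))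
      (f₂ := fun s t => ContinuousLinearMap.toSpanSingleton ℝ (I w (s, t)))
      h1 h2 (hc v).continuousAt (hc w).continuousAt).hasFDerivAt
    have he : f' z = (ContinuousLinearMap.toSpanSingleton ℝ (I v z)).coprod
        (ContinuousLinearMap.toSpanSingleton ℝ (I w z)) := by
      ext <;> simp [f']
    rw [he]
    exact this
  have hd : Differentiable ℝ f' := by
    have := fun g => (hI g).differentiable (by simp)
    have h1 := this v
    have h2 := this w
    fun_prop
  have hsymm := second_derivative_symmetric_of_eventually (𝕜 := ℝ) hf (hd 0).hasFDerivAt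
    (1, 0) (0, 1)
  have happ (a b : ℝ × ℝ) : fderiv ℝ f' 0 a b = fderiv ℝ (fun z => f' z b) 0 a := by
    rw [fderiv_clm_apply (hd 0) (differentiableAt_const b)]
    simp
  rw [happ, happ] at hsymm
  have e1 : (fun z => f' z (0, 1)) = I w := by funext z; simp [f']
  have e2 : (fun z => f' z (1, 0)) = I v := by funext z; simp [f']
  rw [e1, e2, hI', hI'] at hsymm
  -- Identifies the mixed partial derivatives in Schwarz's theorem as pairings with the second
  -- variation.
  have key (a : ℝ × ℝ) (g : SmoothFn d M) (hg : g = a.1 • v + a.2 • w) :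
      hq.lineDeriv a 0 = Φ.secondVariation η g := by
    have h1 := hq.hasVelocity_line 0 a
    simp only [zero_add] at h1
    refine HasVelocity.unique h1 (((Φ.germSmooth_δF hη).hasVelocity_dirDeriv g).congr ?_)
    have : Filter.Tendsto (fun t : ℝ => t • a) (𝓝 0) (𝓝 0) :=
      Continuous.tendsto' (by fun_prop) _ _ (by simp)
    filter_upwards [this.eventually h] with t ht
    rw [← ht, hg, smul_add, smul_smul, smul_smul, add_assoc]
    rfl
  rw [key (1, 0) v (by simp), key (0, 1) w (by simp)] at hsymm
  rw [hsymm, pairing_comm]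

end InvertiblePotential

/-! ### Curves and plots of pairs; commuting second derivatives. -/

section Carrier

variable {d : ℕ} {M : Type*} [TopologicalSpace M] [ChartedSpace (EuclideanSpace ℝ (Fin d)) M]

theorem dSmooth_carrier_iff {A : Set (SmoothFn d M × SmoothFn d M)} {c : ℝ → A} :
    DSmooth c ↔ (SmoothFamily fun t => (c t).1.1) ∧ SmoothFamily fun t => (c t).1.2 := by
  rw [dSmooth_subtype_iff, dSmooth_prod_iff, dSmooth_iff_smoothFamily, dSmooth_iff_smoothFamily]

theorem isPlot_carrier_iff {A : Set (SmoothFn d M × SmoothFn d M)} {n : ℕ}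
    {p : EuclideanSpace ℝ (Fin n) → A} :
    IsPlot p ↔ (SmoothFamily fun u => (p u).1.1) ∧ SmoothFamily fun u => (p u).1.2 :=
  Iff.rfl

theorem PhaseSpace.vel_eq (A : PhaseSpace d M) {c : ℝ → A.carrier} {v w : SmoothFn d M}
    (hv : HasVelocity (fun t => (c t).1.1) v) (hw : HasVelocity (fun t => (c t).1.2) w) :
    A.vel c = (v, w) :=
  Prod.ext hv.velocity_eq hw.velocity_eq

variable [IsManifold (𝓡 d) ∞ M]

theorem SmoothFamily.lineDeriv_comm {V : Type*} [NormedAddCommGroup V] [NormedSpace ℝ V]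
    {p : V → SmoothFn d M} (hp : SmoothFamily p) (a b u : V) :
    (hp.smoothFamily_lineDeriv a).lineDeriv b u = (hp.smoothFamily_lineDeriv b).lineDeriv a u := by
  ext x
  have hd : DifferentiableAt ℝ (fderiv ℝ fun u => p u x) u :=
    ((hp.contDiff_apply x).fderiv_right (m := ∞) (by simp)).differentiable (by simp) u
  have happ (a b : V) : fderiv ℝ (fun u => fderiv ℝ (fun u => p u x) u a) u b =
      fderiv ℝ (fderiv ℝ fun u => p u x) u b a := by
    rw [fderiv_clm_apply hd (differentiableAt_const a)]
    simp
  simp only [lineDeriv_apply, happ]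
  exact ((hp.contDiff_apply x).contDiffAt.isSymmSndFDerivAt
    (by rw [minSmoothness_of_isRCLikeNormedField]; norm_cast)) b a

/-- Curves which differ by constants have velocities which differ by a constant. -/
theorem exists_velocity_eq_add_const {c c' : ℝ → SmoothFn d M} (hc : SmoothFamily c)
    (hc' : SmoothFamily c') (h : ∀ t, ∃ k : ℝ, ∀ x, c' t x = c t x + k) :
    ∃ k : ℝ, velocity c' = velocity c + k • 1 := by
  rcases isEmpty_or_nonempty M with hM | ⟨⟨x₀⟩⟩
  · exact ⟨0, ContMDiffMap.ext fun x => hM.elim x⟩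
  -- The constants `k(t)` are not assumed to depend smoothly on `t`; evaluation at `x₀` writes them
  -- as a difference of differentiable functions.
  · refine ⟨velocity c' x₀ - velocity c x₀, ContMDiffMap.ext fun x => ?_⟩
    have h1 (x : M) := (hc'.hasVelocity x).sub (hc.hasVelocity x)
    have h2 := (h1 x).congr_of_eventuallyEq (.of_forall fun t => ?_ :
      (fun t => c' t x₀ - c t x₀) =ᶠ[𝓝 0] _)
    · have := h2.unique (h1 x₀)
      simp only [ContMDiffMap.coe_add, ContMDiffMap.coe_smul, ContMDiffMap.coe_one, Pi.add_apply,
        Pi.smul_apply, Pi.one_apply, smul_eq_mul, mul_one]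
      linarith
    · obtain ⟨k, hk⟩ := h t
      simp [hk]

end Carrier

/-! ### The canonical form on `T^*P(M)` is symplectic. -/

section Wasserstein

variable {d : ℕ} {M : Type*} [TopologicalSpace M] [CompactSpace M]
  [ChartedSpace (EuclideanSpace ℝ (Fin d)) M] [MeasurableSpace M] [BorelSpace M]
  {μ : Measure M} [IsFiniteMeasure μ]

theorem wassersteinForm_eq (z : (cotangentBundle (d := d) μ).carrier)
    (v w : SmoothFn d M × SmoothFn d M) :
    wassersteinForm μ z v w = pairing μ v.1 w.2 - pairing μ w.1 v.2 :=
  integral_pairing_sub μ v.1 w.2 w.1 v.2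

/-- Curves must stay in the densities for all real times, while `ρ + t r` may lose positivity.
Replacing `t` by `sin(D t) / D` keeps the velocity at `0` and bounds the perturbation by `|r| / D <
ρ`. -/
theorem exists_curve_in_densities {ρ r : SmoothFn d M} (hρ : ρ ∈ densities μ)
    (hr : pairing μ r 1 = 0) :
    ∃ c : ℝ → SmoothFn d M, SmoothFamily c ∧ c 0 = ρ ∧ HasVelocity c r ∧
      ∀ t, c t ∈ densities μ := by
  have hcont : Continuous fun x => r x / ρ x :=
    r.contMDiff.continuous.div₀ ρ.contMDiff.continuous fun x => (hρ.1 x).ne'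
  obtain ⟨C, hC⟩ := isCompact_univ.exists_bound_of_continuousOn hcont.continuousOn
  -- The `+ 1` makes `D` positive and the bound `|r| < D ρ` strict.
  set D : ℝ := |C| + 1 with hD
  have hD0 : 0 < D := by positivity
  have hrC (x : M) : |r x| < D * ρ x := by
    have h1 := hC x (Set.mem_univ x)
    rw [Real.norm_eq_abs, abs_div, abs_of_pos (hρ.1 x), div_le_iff₀ (hρ.1 x)] at h1
    nlinarith [le_abs_self C, hρ.1 x]
  refine ⟨fun t => ρ + (Real.sin (D * t) / D) • r, ?_, by simp, fun x => ?_,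
    fun t => ⟨fun x => ?_, ?_⟩⟩
  · refine (SmoothFamily.const ρ).add ((SmoothFamily.const r).smul ?_)
    exact (Real.contDiff_sin.comp (contDiff_const.mul contDiff_id)).div_const D
  · have h1 : HasDerivAt (fun t : ℝ => D * t) D 0 := by
      simpa using (hasDerivAt_id (0 : ℝ)).const_mul D
    have h2 : HasDerivAt (fun t : ℝ => Real.sin (D * t) / D) 1 0 := by
      simpa [hD0.ne'] using h1.sin.div_const D
    simpa using (h2.mul_const (r x)).const_add (ρ x)
  · change 0 < ρ x + Real.sin (D * t) / D * r x
    have h1 : |Real.sin (D * t) / D * r x| < ρ x := by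
      rw [abs_mul, abs_div, abs_of_pos hD0, div_mul_eq_mul_div, div_lt_iff₀ hD0]
      nlinarith [Real.abs_sin_le_one (D * t), hrC x, abs_nonneg (r x)]
    linarith [(abs_lt.1 h1).1]
  · have h1 : ∫ x, r x ∂μ = 0 := by simpa [pairing] using hr
    change ∫ x, (ρ x + Real.sin (D * t) / D * r x) ∂μ = 1
    rw [integral_add (integrable_smoothFn μ ρ) ((integrable_smoothFn μ r).const_mul _),
      integral_const_mul, h1, hρ.2]
    simp

variable [IsManifold (𝓡 d) ∞ M]

theorem pairing_velocity_one {c : ℝ → SmoothFn d M} (hc : SmoothFamily c)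
    (h : ∀ t, c t ∈ densities μ) {r : SmoothFn d M} (hr : HasVelocity c r) :
    pairing μ r 1 = 0 := by
  have h1 := hc.fderiv_integral μ 0 1
  have h2 := hc.hasVelocity_line 0 1
  simp only [zero_add, smul_eq_mul, mul_one] at h2
  rw [h2.unique hr] at h1
  simp only [fun t => (h t).2] at h1
  simpa [pairing] using h1.symm

/-- Conservation of total mass is the only constraint on velocities. This makes every pair with
mean-zero first component available as a test vector. -/
theorem mem_tangent_cotangentBundle_iff {z : (cotangentBundle (d := d) μ).carrier}
    {v : SmoothFn d M × SmoothFn d M} :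
    v ∈ (cotangentBundle μ).tangent z ↔ pairing μ v.1 1 = 0 := by
  constructor
  · rintro ⟨c, hc, -, rfl⟩
    rw [dSmooth_carrier_iff] at hc
    exact pairing_velocity_one hc.1 (fun t => (c t).2) hc.1.hasVelocity
  · intro hv
    obtain ⟨c, hc, h0, hcv, hmem⟩ := exists_curve_in_densities z.2 hv
    refine ⟨fun t => ⟨(c t, z.1.2 + t • v.2), hmem t⟩, dSmooth_carrier_iff.2
      ⟨hc, smoothFamily_line _ _⟩, Subtype.ext (Prod.ext h0 (by simp)),
      PhaseSpace.vel_eq _ hcv (hasVelocity_line _ _)⟩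

theorem pullbackCoeff_wassersteinForm {n : ℕ}
    {p : EuclideanSpace ℝ (Fin n) → (cotangentBundle (d := d) μ).carrier}
    (h₁ : SmoothFamily fun u => (p u).1.1) (h₂ : SmoothFamily fun u => (p u).1.2)
    (a b : EuclideanSpace ℝ (Fin n)) :
    (cotangentBundle μ).pullbackCoeff (wassersteinForm μ) p a b = fun u =>
      pairing μ (h₁.lineDeriv a u) (h₂.lineDeriv b u) -
        pairing μ (h₁.lineDeriv b u) (h₂.lineDeriv a u) := by
  funext u
  rw [PhaseSpace.pullbackCoeff, wassersteinForm_eq,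
    PhaseSpace.vel_eq _ (h₁.hasVelocity_line u a) (h₂.hasVelocity_line u a),
    PhaseSpace.vel_eq _ (h₁.hasVelocity_line u b) (h₂.hasVelocity_line u b)]

theorem fderiv_pullbackCoeff_wassersteinForm {n : ℕ}
    {p : EuclideanSpace ℝ (Fin n) → (cotangentBundle (d := d) μ).carrier}
    (h₁ : SmoothFamily fun u => (p u).1.1) (h₂ : SmoothFamily fun u => (p u).1.2)
    (a b c u : EuclideanSpace ℝ (Fin n)) :
    fderiv ℝ ((cotangentBundle μ).pullbackCoeff (wassersteinForm μ) p a b) u c =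
      pairing μ ((h₁.smoothFamily_lineDeriv a).lineDeriv c u) (h₂.lineDeriv b u) +
      pairing μ (h₁.lineDeriv a u) ((h₂.smoothFamily_lineDeriv b).lineDeriv c u) -
      (pairing μ ((h₁.smoothFamily_lineDeriv b).lineDeriv c u) (h₂.lineDeriv a u) +
      pairing μ (h₁.lineDeriv b u) ((h₂.smoothFamily_lineDeriv a).lineDeriv c u)) := by
  have hd (a b : EuclideanSpace ℝ (Fin n)) : DifferentiableAt ℝ
      (fun u => pairing μ (h₁.lineDeriv a u) (h₂.lineDeriv b u)) u :=
    ((h₁.smoothFamily_lineDeriv a).contDiff_pairing μ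
      (h₂.smoothFamily_lineDeriv b)).differentiable (by simp) u
  rw [pullbackCoeff_wassersteinForm h₁ h₂, fderiv_fun_sub (hd a b) (hd b a),
    ← (h₁.smoothFamily_lineDeriv a).fderiv_pairing μ (h₂.smoothFamily_lineDeriv b),
    ← (h₁.smoothFamily_lineDeriv b).fderiv_pairing μ (h₂.smoothFamily_lineDeriv a)]
  rfl

theorem isSymplecticForm_wassersteinForm [μ.IsOpenPosMeasure] :
    (cotangentBundle (d := d) μ).IsSymplecticForm (wassersteinForm μ) where
  add_left z v _ v' _ w _ := by
    simp only [wassersteinForm_eq, Prod.fst_add, Prod.snd_add, pairing_add_left,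
      pairing_add_right]
    ring
  smul_left z r v _ w _ := by
    simp only [wassersteinForm_eq, Prod.smul_fst, Prod.smul_snd, pairing_smul_left,
      pairing_smul_right]
    ring
  skew z v _ w _ := by
    simp only [wassersteinForm_eq]
    ring
  descends c₁ c₂ c₁' c₂' hc₁ hc₂ hc₁' hc₂' _ _ hr₁ hr₂ := by
    rw [dSmooth_carrier_iff] at hc₁ hc₂ hc₁' hc₂'
    have e₁ : (fun t => (c₁' t).1.1) = fun t => (c₁ t).1.1 := funext fun t => (hr₁ t).1.symm
    have e₂ : (fun t => (c₂' t).1.1) = fun t => (c₂ t).1.1 := funext fun t => (hr₂ t).1.symm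
    obtain ⟨k₁, hk₁⟩ := exists_velocity_eq_add_const hc₁.2 hc₁'.2 fun t => (hr₁ t).2
    obtain ⟨k₂, hk₂⟩ := exists_velocity_eq_add_const hc₂.2 hc₂'.2 fun t => (hr₂ t).2
    -- The representatives `Ṡ` change by constants, which pair to zero with the mean-zero `ρ̇`.
    simp only [wassersteinForm_eq, PhaseSpace.vel, velocityPair, e₁, e₂, hk₁, hk₂,
      pairing_add_right, pairing_smul_right,
      pairing_velocity_one hc₁.1 (fun t => (c₁ t).2) hc₁.1.hasVelocity,
      pairing_velocity_one hc₂.1 (fun t => (c₂ t).2) hc₂.1.hasVelocity]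
    ring
  nondegenerate z v hv h := by
    rw [mem_tangent_cotangentBundle_iff] at hv
    simp only [mem_tangent_cotangentBundle_iff, wassersteinForm_eq] at h
    have hz (f : SmoothFn d M) : pairing μ 0 f = 0 := by simp [pairing]
    have h1 : v.1 = 0 := by
      -- Testing against `(0, ρ̇)` gives `⟨ρ̇, ρ̇⟩ = 0`.
      have := h (0, v.1) (hz _)
      rw [hz, sub_zero] at this
      exact eq_zero_of_pairing_self μ this
    -- The total mass is non-zero: otherwise `1 = 0` as functions, so the density at the base point
    -- would vanish although its integral is `1`.
    have hone : pairing μ (1 : SmoothFn d M) 1 ≠ 0 := by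
      intro h0
      have h01 := eq_zero_of_pairing_self μ h0
      have h2 : z.1.1 = 0 := by rw [← mul_one z.1.1, h01, mul_zero]
      have h3 := z.2.2
      rw [h2] at h3
      simp at h3
    -- The mean of `Ṡ`. Testing against `(Ṡ - m, 0)`, together with `⟨Ṡ - m, 1⟩ = 0`, gives `⟨Ṡ - m,
    -- Ṡ - m⟩ = 0`; thus `Ṡ` is constant and the vector is vertical.
    set m := pairing μ v.2 1 / pairing μ (1 : SmoothFn d M) 1 with hm
    have hr : pairing μ (v.2 - m • 1) 1 = 0 := by
      rw [pairing_sub_left, pairing_smul_left, hm, div_mul_cancel₀ _ hone, sub_self]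
    have h2 : v.2 - m • 1 = 0 := by
      have := h (v.2 - m • 1, 0) hr
      rw [h1, hz, zero_sub, neg_eq_zero] at this
      apply eq_zero_of_pairing_self μ
      rw [pairing_sub_right, pairing_smul_right, hr, this]
      simp
    refine ⟨fun t => ⟨(z.1.1, z.1.2 + t • (m • 1)), z.2⟩, dSmooth_carrier_iff.2
      ⟨.const _, smoothFamily_line _ _⟩, Subtype.ext (Prod.ext rfl (by simp)),
      fun t => ⟨rfl, -(t * m), fun x => ?_⟩, ?_⟩
    · simp
    · exact Prod.ext ((hasVelocity_const z.1.1).velocity_eq.trans h1.symm)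
        ((hasVelocity_line z.1.2 (m • 1)).velocity_eq.trans (sub_eq_zero.1 h2).symm)
  smooth n p hp a b := by
    obtain ⟨h₁, h₂⟩ := isPlot_carrier_iff.1 hp
    rw [pullbackCoeff_wassersteinForm h₁ h₂]
    exact ((h₁.smoothFamily_lineDeriv a).contDiff_pairing μ (h₂.smoothFamily_lineDeriv b)).sub
      ((h₁.smoothFamily_lineDeriv b).contDiff_pairing μ (h₂.smoothFamily_lineDeriv a))
  closed n p hp a b c u := by
    obtain ⟨h₁, h₂⟩ := isPlot_carrier_iff.1 hp
    simp only [fderiv_pullbackCoeff_wassersteinForm h₁ h₂]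
    -- Once the second derivatives are in a common order, the twelve terms of the cyclic sum cancel
    -- in pairs.
    rw [h₁.lineDeriv_comm b a, h₁.lineDeriv_comm c a, h₁.lineDeriv_comm c b,
      h₂.lineDeriv_comm b a, h₂.lineDeriv_comm c a, h₂.lineDeriv_comm c b]
    ring

end Wasserstein

/-! ### Smooth maps out of a quotient. -/

theorem dSmooth_quotient_mk {Z : Type*} [DiffeologicalSpace Z] (r : Setoid Z) :
    DSmooth (Quotient.mk r) := fun _ p hp =>
  DiffeologicalSpace.isPlot_generatedFrom_of_mem ⟨p, hp, rfl⟩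

theorem dSmooth_of_comp_quotient_mk {Y Z : Type*} [DiffeologicalSpace Y] [DiffeologicalSpace Z]
    {r : Setoid Z} {f : Quotient r → Y} (hf : DSmooth fun z => f (Quotient.mk r z)) :
    DSmooth f := by
  -- The pull-back diffeology along `f`. It contains the generating plots of the quotient
  -- diffeology, hence all its plots.
  let D : DiffeologicalSpace (Quotient r) :=
    { plots := fun n => {p | IsPlot (f ∘ p)}
      constant_plots := fun _ => isPlot_const
      plot_reparam := fun hp hg => isPlot_reparam hp hg
      locality := fun {n p} hp => DiffeologicalSpace.locality fun x => by
        obtain ⟨u, hu, hx, h⟩ := hp x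
        exact ⟨u, hu, hx, fun {m g} hg hg' => h hg hg'⟩ }
  intro n p hp
  refine hp D ?_
  rintro ⟨m, s⟩ ⟨q, hq, hs⟩
  change IsPlot (f ∘ s)
  rw [show s = fun u => Quotient.mk r (q u) from hs]
  exact hf m q hq

/-! ### The Hopf–Cole transformation as a symplectomorphism. -/

namespace InvertiblePotential

variable {d : ℕ} {M : Type*} [TopologicalSpace M]
  [ChartedSpace (EuclideanSpace ℝ (Fin d)) M] [MeasurableSpace M]
  {μ : Measure M} (Φ : InvertiblePotential d μ)

theorem fst_mem_dom {z : SmoothFn d M × SmoothFn d M} (hz : z ∈ Φ.hopfColeSpace.carrier) :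
    z.1 ∈ Φ.dom := by
  obtain ⟨ρ, _, S, h, _⟩ := hz
  rw [h]
  exact Φ.δFinv_mem _

theorem snd_mem_dom {z : SmoothFn d M × SmoothFn d M} (hz : z ∈ Φ.hopfColeSpace.carrier) :
    z.2 ∈ Φ.dom := by
  obtain ⟨ρ, _, S, _, h⟩ := hz
  rw [h]
  exact Φ.δFinv_mem _

theorem δF_density (z : SmoothFn d M × SmoothFn d M) :
    Φ.δF (Φ.density z) = Φ.δF z.1 + Φ.δF z.2 :=
  Φ.δF_δFinv _

theorem density_mem_dom (z : SmoothFn d M × SmoothFn d M) : Φ.density z ∈ Φ.dom :=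
  Φ.δFinv_mem _

/-- The inverse `(ρ, S) ↦ (η, η^*)` of the generalized Hopf–Cole transformation. -/
noncomputable def hopfColeInv (q : (cotangentBundle (d := d) μ).carrier) :
    Φ.hopfColeSpace.carrier :=
  ⟨(Φ.δFinv ((1 / 2 : ℝ) • (Φ.δF q.1.1 + q.1.2)), Φ.δFinv ((1 / 2 : ℝ) • (Φ.δF q.1.1 - q.1.2))),
    q.1.1, q.2, q.1.2, rfl, rfl⟩

theorem hopfColeInv_hopfCole (z : Φ.hopfColeSpace.carrier) :
    Φ.hopfColeInv (Φ.hopfCole z) = z := by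
  refine Subtype.ext (Prod.ext ?_ ?_)
  · refine Eq.trans (congrArg Φ.δFinv ?_) (Φ.δFinv_δF (Φ.fst_mem_dom z.2))
    change (1 / 2 : ℝ) • (Φ.δF (Φ.density z.1) + (Φ.δF z.1.1 - Φ.δF z.1.2)) = _
    rw [δF_density]
    module
  · refine Eq.trans (congrArg Φ.δFinv ?_) (Φ.δFinv_δF (Φ.snd_mem_dom z.2))
    change (1 / 2 : ℝ) • (Φ.δF (Φ.density z.1) - (Φ.δF z.1.1 - Φ.δF z.1.2)) = _
    rw [δF_density]
    module

theorem hopfCole_hopfColeInv (q : (cotangentBundle (d := d) μ).carrier) :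
    Φ.hopfCole (Φ.hopfColeInv q) = q := by
  refine Subtype.ext (Prod.ext ?_ ?_)
  · refine Eq.trans (congrArg Φ.δFinv ?_) (Φ.δFinv_δF (Φ.densities_subset q.2))
    change Φ.δF (Φ.δFinv _) + Φ.δF (Φ.δFinv _) = _
    rw [δF_δFinv, δF_δFinv]
    module
  · change Φ.δF (Φ.δFinv _) - Φ.δF (Φ.δFinv _) = _
    rw [δF_δFinv, δF_δFinv]
    module

/-- The generalized Hopf–Cole transformation as a bijection of representatives. -/
noncomputable def hopfColeEquiv :
    Φ.hopfColeSpace.carrier ≃ (cotangentBundle (d := d) μ).carrier where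
  toFun := Φ.hopfCole
  invFun := Φ.hopfColeInv
  left_inv := Φ.hopfColeInv_hopfCole
  right_inv := Φ.hopfCole_hopfColeInv

/-- Replacing `(f, g)` by `(f + k, g - k)` preserves `f + g` and adds `2k` to `f - g`; conversely,
sum and difference determine `f` and `g`. -/
theorem rel_hopfCole_iff (z z' : Φ.hopfColeSpace.carrier) :
    Φ.hopfColeSpace.rel z z' ↔ (cotangentBundle μ).rel (Φ.hopfCole z) (Φ.hopfCole z') := by
  constructor
  · rintro ⟨k, hk⟩
    refine ⟨congrArg Φ.δFinv (ContMDiffMap.ext fun x => ?_), 2 * k, fun x => ?_⟩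
    · change Φ.δF z.1.1 x + Φ.δF z.1.2 x = Φ.δF z'.1.1 x + Φ.δF z'.1.2 x
      linarith [(hk x).1, (hk x).2]
    · change Φ.δF z'.1.1 x - Φ.δF z'.1.2 x = Φ.δF z.1.1 x - Φ.δF z.1.2 x + 2 * k
      linarith [(hk x).1, (hk x).2]
  · rintro ⟨h, k, hk⟩
    refine ⟨k / 2, fun x => ?_⟩
    have h1 : Φ.δF z.1.1 x + Φ.δF z.1.2 x = Φ.δF z'.1.1 x + Φ.δF z'.1.2 x := by
      have := congrArg Φ.δF h
      change Φ.δF (Φ.density z.1) = Φ.δF (Φ.density z'.1) at this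
      rw [δF_density, δF_density] at this
      exact congrArg (fun f : SmoothFn d M => f x) this
    have h2 : Φ.δF z'.1.1 x - Φ.δF z'.1.2 x = Φ.δF z.1.1 x - Φ.δF z.1.2 x + k := hk x
    constructor <;> linarith

theorem dSmooth_hopfCole : DSmooth Φ.hopfCole := fun n p hp => by
  obtain ⟨h₁, h₂⟩ := isPlot_carrier_iff.1 hp
  have h₁' := Φ.smoothFamily_δF h₁ fun u => Φ.fst_mem_dom (p u).2
  have h₂' := Φ.smoothFamily_δF h₂ fun u => Φ.snd_mem_dom (p u).2
  exact isPlot_carrier_iff.2 ⟨Φ.smoothFamily_δFinv (h₁'.add h₂'), h₁'.sub h₂'⟩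

theorem dSmooth_hopfColeInv : DSmooth Φ.hopfColeInv := fun n p hp => by
  obtain ⟨h₁, h₂⟩ := isPlot_carrier_iff.1 hp
  have h₁' := Φ.smoothFamily_δF h₁ fun u => Φ.densities_subset (p u).2
  exact isPlot_carrier_iff.2 ⟨Φ.smoothFamily_δFinv ((h₁'.add h₂).smul contDiff_const),
    Φ.smoothFamily_δFinv ((h₁'.sub h₂).smul contDiff_const)⟩

theorem exists_equiv_points : ∃ e : Φ.hopfColeSpace.Point ≃ (cotangentBundle (d := d) μ).Point,
    (∀ z, e (Quotient.mk _ z) = Quotient.mk _ (Φ.hopfCole z)) ∧ DSmooth e ∧ DSmooth e.symm :=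
  ⟨Quotient.congr Φ.hopfColeEquiv Φ.rel_hopfCole_iff, fun _ => rfl,
    dSmooth_of_comp_quotient_mk ((dSmooth_quotient_mk _).comp Φ.dSmooth_hopfCole),
    dSmooth_of_comp_quotient_mk ((dSmooth_quotient_mk _).comp Φ.dSmooth_hopfColeInv)⟩

variable [IsManifold (𝓡 d) ∞ M]

theorem secondVariation_add {η : SmoothFn d M} (hη : η ∈ Φ.dom) (v w : SmoothFn d M) :
    Φ.secondVariation η (v + w) = Φ.secondVariation η v + Φ.secondVariation η w :=
  (Φ.germSmooth_δF hη).dirDeriv_add v w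

theorem secondVariation_smul {η : SmoothFn d M} (hη : η ∈ Φ.dom) (r : ℝ) (v : SmoothFn d M) :
    Φ.secondVariation η (r • v) = r • Φ.secondVariation η v :=
  (Φ.germSmooth_δF hη).dirDeriv_smul r v

theorem invFun_secondVariation_density (z : SmoothFn d M × SmoothFn d M) :
    Function.invFun (Φ.secondVariation (Φ.density z)) =
      dirDeriv Φ.δFinv (Φ.δF z.1 + Φ.δF z.2) := by
  rw [Φ.invFun_secondVariation (Φ.density_mem_dom z), δF_density]

/-- The inverse `-2 δ²F(η^*) [δ²F(ρ)]⁻¹ δ²F(η)` of `σ(η, η^*)`. -/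
noncomputable def sigmaInv (z : SmoothFn d M × SmoothFn d M) (v : SmoothFn d M) : SmoothFn d M :=
  (-2 : ℝ) • Φ.secondVariation z.2
    (dirDeriv Φ.δFinv (Φ.δF z.1 + Φ.δF z.2) (Φ.secondVariation z.1 v))

theorem sigma_sigmaInv {z : SmoothFn d M × SmoothFn d M} (h₁ : z.1 ∈ Φ.dom) (h₂ : z.2 ∈ Φ.dom)
    (v : SmoothFn d M) : Φ.sigma z (Φ.sigmaInv z v) = v := by
  have hb := Φ.bijective_secondVariation (Φ.density_mem_dom z)
  rw [sigma, sigmaInv, ← Φ.secondVariation_smul h₂,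
    Function.leftInverse_invFun (Φ.bijective_secondVariation h₂).injective,
    Φ.secondVariation_smul (Φ.density_mem_dom z), ← Φ.invFun_secondVariation_density,
    Function.rightInverse_invFun hb.surjective, ← Φ.secondVariation_smul h₁,
    Function.leftInverse_invFun (Φ.bijective_secondVariation h₁).injective, smul_smul]
  norm_num

theorem sigmaInv_sigma {z : SmoothFn d M × SmoothFn d M} (h₁ : z.1 ∈ Φ.dom) (h₂ : z.2 ∈ Φ.dom)
    (α : SmoothFn d M) : Φ.sigmaInv z (Φ.sigma z α) = α := by
  have hb := Φ.bijective_secondVariation (Φ.density_mem_dom z)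
  rw [sigma, sigmaInv, Φ.secondVariation_smul h₁,
    Function.rightInverse_invFun (Φ.bijective_secondVariation h₁).surjective,
    ← Φ.secondVariation_smul (Φ.density_mem_dom z), ← Φ.invFun_secondVariation_density,
    Function.leftInverse_invFun hb.injective, Φ.secondVariation_smul h₂,
    Function.rightInverse_invFun (Φ.bijective_secondVariation h₂).surjective, smul_smul]
  norm_num

theorem bijective_sigma {z : SmoothFn d M × SmoothFn d M} (hz : z ∈ Φ.hopfColeSpace.carrier) :
    Function.Bijective (Φ.sigma z) :=
  Function.bijective_iff_has_inverse.2 ⟨Φ.sigmaInv z,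
    Φ.sigmaInv_sigma (Φ.fst_mem_dom hz) (Φ.snd_mem_dom hz),
    Φ.sigma_sigmaInv (Φ.fst_mem_dom hz) (Φ.snd_mem_dom hz)⟩

theorem invFun_sigma {z : SmoothFn d M × SmoothFn d M} (hz : z ∈ Φ.hopfColeSpace.carrier) :
    Function.invFun (Φ.sigma z) = Φ.sigmaInv z := by
  funext v
  apply (Φ.bijective_sigma hz).injective
  rw [Function.rightInverse_invFun (Φ.bijective_sigma hz).surjective v,
    Φ.sigma_sigmaInv (Φ.fst_mem_dom hz) (Φ.snd_mem_dom hz)]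

theorem sigmaInv_add {z : SmoothFn d M × SmoothFn d M} (hz : z ∈ Φ.hopfColeSpace.carrier)
    (v w : SmoothFn d M) : Φ.sigmaInv z (v + w) = Φ.sigmaInv z v + Φ.sigmaInv z w := by
  simp only [sigmaInv, Φ.secondVariation_add (Φ.fst_mem_dom hz),
    Φ.secondVariation_add (Φ.snd_mem_dom hz), (Φ.germSmooth_δFinv _).dirDeriv_add, smul_add]

theorem sigmaInv_smul {z : SmoothFn d M × SmoothFn d M} (hz : z ∈ Φ.hopfColeSpace.carrier)
    (r : ℝ) (v : SmoothFn d M) : Φ.sigmaInv z (r • v) = r • Φ.sigmaInv z v := by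
  simp only [sigmaInv, Φ.secondVariation_smul (Φ.fst_mem_dom hz),
    Φ.secondVariation_smul (Φ.snd_mem_dom hz), (Φ.germSmooth_δFinv _).dirDeriv_smul,
    smul_comm r]

theorem vel_hopfCole {c : ℝ → Φ.hopfColeSpace.carrier} (hc : DSmooth c) :
    (cotangentBundle μ).vel (fun t => Φ.hopfCole (c t)) =
      (dirDeriv Φ.δFinv (Φ.δF (c 0).1.1 + Φ.δF (c 0).1.2)
        (Φ.secondVariation (c 0).1.1 (Φ.hopfColeSpace.vel c).1 +
          Φ.secondVariation (c 0).1.2 (Φ.hopfColeSpace.vel c).2),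
       Φ.secondVariation (c 0).1.1 (Φ.hopfColeSpace.vel c).1 -
          Φ.secondVariation (c 0).1.2 (Φ.hopfColeSpace.vel c).2) := by
  obtain ⟨h₁, h₂⟩ := dSmooth_carrier_iff.1 hc
  have v₁ := (Φ.germSmooth_δF (Φ.fst_mem_dom (c 0).2)).hasVelocity_comp h₁ rfl h₁.hasVelocity
  have v₂ := (Φ.germSmooth_δF (Φ.snd_mem_dom (c 0).2)).hasVelocity_comp h₂ rfl h₂.hasVelocity
  have h₁' := Φ.smoothFamily_δF h₁ fun u => Φ.fst_mem_dom (c u).2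
  have h₂' := Φ.smoothFamily_δF h₂ fun u => Φ.snd_mem_dom (c u).2
  exact PhaseSpace.vel_eq _
    ((Φ.germSmooth_δFinv _).hasVelocity_comp (h₁'.add h₂') rfl (v₁.add v₂)) (v₁.sub v₂)

theorem vel_hopfColeInv {c : ℝ → (cotangentBundle (d := d) μ).carrier} (hc : DSmooth c) :
    Φ.hopfColeSpace.vel (fun t => Φ.hopfColeInv (c t)) =
      (dirDeriv Φ.δFinv ((1 / 2 : ℝ) • (Φ.δF (c 0).1.1 + (c 0).1.2))
        ((1 / 2 : ℝ) • (Φ.secondVariation (c 0).1.1 ((cotangentBundle μ).vel c).1 +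
          ((cotangentBundle μ).vel c).2)),
       dirDeriv Φ.δFinv ((1 / 2 : ℝ) • (Φ.δF (c 0).1.1 - (c 0).1.2))
        ((1 / 2 : ℝ) • (Φ.secondVariation (c 0).1.1 ((cotangentBundle μ).vel c).1 -
          ((cotangentBundle μ).vel c).2))) := by
  obtain ⟨h₁, h₂⟩ := dSmooth_carrier_iff.1 hc
  have v₁ := (Φ.germSmooth_δF (Φ.densities_subset (c 0).2)).hasVelocity_comp h₁ rfl
    h₁.hasVelocity
  have v₂ := h₂.hasVelocity
  have h₁' := Φ.smoothFamily_δF h₁ fun u => Φ.densities_subset (c u).2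
  exact PhaseSpace.vel_eq _
    ((Φ.germSmooth_δFinv _).hasVelocity_comp ((h₁'.add h₂).smul contDiff_const) rfl
      ((v₁.add v₂).const_smul _))
    ((Φ.germSmooth_δFinv _).hasVelocity_comp ((h₁'.sub h₂).smul contDiff_const) rfl
      ((v₁.sub v₂).const_smul _))

variable [CompactSpace M] [BorelSpace M] [IsFiniteMeasure μ]

/-- The inverse of a symmetric operator is symmetric. -/
theorem pairing_dirDeriv_δFinv (f v w : SmoothFn d M) :
    pairing μ (dirDeriv Φ.δFinv f v) w = pairing μ v (dirDeriv Φ.δFinv f w) := by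
  have h := Φ.pairing_secondVariation (Φ.δFinv_mem f) (dirDeriv Φ.δFinv f v)
    (dirDeriv Φ.δFinv f w)
  rw [secondVariation_dirDeriv_δFinv, secondVariation_dirDeriv_δFinv] at h
  exact h.symm

theorem hopfColeForm_eq (z : Φ.hopfColeSpace.carrier) (v w : SmoothFn d M × SmoothFn d M) :
    Φ.hopfColeForm z v w =
      pairing μ (Φ.sigmaInv z.1 v.1) w.2 - pairing μ (Φ.sigmaInv z.1 w.1) v.2 := by
  rw [hopfColeForm, Φ.invFun_sigma z.2]
  exact integral_pairing_sub μ _ _ _ _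

/-- The central computation. Expanding `⟨R⁻¹(a₁ + b₁), a₂ - b₂⟩ - ⟨R⁻¹(a₂ + b₂), a₁ - b₁⟩`, the
symmetry of `R⁻¹` cancels the pure terms and doubles the mixed ones. -/
theorem wassersteinForm_vel_hopfCole (c₁ c₂ : ℝ → Φ.hopfColeSpace.carrier) (hc₁ : DSmooth c₁)
    (hc₂ : DSmooth c₂) (h0 : c₁ 0 = c₂ 0) :
    wassersteinForm μ (Φ.hopfCole (c₁ 0)) ((cotangentBundle μ).vel fun t => Φ.hopfCole (c₁ t))
      ((cotangentBundle μ).vel fun t => Φ.hopfCole (c₂ t)) =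
      Φ.hopfColeForm (c₁ 0) (Φ.hopfColeSpace.vel c₁) (Φ.hopfColeSpace.vel c₂) := by
  rw [Φ.vel_hopfCole hc₁, Φ.vel_hopfCole hc₂, wassersteinForm_eq, hopfColeForm_eq, ← h0]
  generalize Φ.hopfColeSpace.vel c₁ = v
  generalize Φ.hopfColeSpace.vel c₂ = w
  have hz := (c₁ 0).2
  generalize (c₁ 0).1 = z at *
  -- Symmetry of the second variation at `η^*` moves it from `σ⁻¹ η̇` onto `η̇^*`; afterwards both
  -- sides involve only `a₁, b₁, a₂, b₂` and `R⁻¹`.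
  simp only [sigmaInv, pairing_smul_left, Φ.pairing_secondVariation (Φ.snd_mem_dom hz)]
  generalize Φ.secondVariation z.1 v.1 = a₁
  generalize Φ.secondVariation z.2 v.2 = b₁
  generalize Φ.secondVariation z.1 w.1 = a₂
  generalize Φ.secondVariation z.2 w.2 = b₂
  have hs (f g : SmoothFn d M) : pairing μ (dirDeriv Φ.δFinv (Φ.δF z.1 + Φ.δF z.2) f) g =
      pairing μ (dirDeriv Φ.δFinv (Φ.δF z.1 + Φ.δF z.2) g) f := by
    rw [pairing_dirDeriv_δFinv, pairing_comm]
  simp only [(Φ.germSmooth_δFinv _).dirDeriv_add, pairing_add_left, pairing_sub_right]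
  rw [hs a₂ a₁, hs b₂ b₁, hs b₁ a₂, hs b₂ a₁]
  ring

/-- Transfers smoothness and closedness from the canonical form, with no need to differentiate `σ`.
-/
theorem pullbackCoeff_hopfColeForm {n : ℕ} {p : EuclideanSpace ℝ (Fin n) → Φ.hopfColeSpace.carrier}
    (hp : IsPlot p) (a b : EuclideanSpace ℝ (Fin n)) :
    Φ.hopfColeSpace.pullbackCoeff Φ.hopfColeForm p a b =
      (cotangentBundle μ).pullbackCoeff (wassersteinForm μ) (fun u => Φ.hopfCole (p u)) a b := by
  funext u
  have hline (a : EuclideanSpace ℝ (Fin n)) : DSmooth fun t : ℝ => p (u + t • a) :=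
    hp.dSmooth.comp (ContDiff.dSmooth (by fun_prop))
  have h := Φ.wassersteinForm_vel_hopfCole _ _ (hline a) (hline b) (by simp)
  simp only [zero_smul, add_zero] at h
  exact h.symm

theorem isSymplecticForm_hopfColeForm [μ.IsOpenPosMeasure] :
    Φ.hopfColeSpace.IsSymplecticForm Φ.hopfColeForm where
  add_left z v _ v' _ w _ := by
    simp only [hopfColeForm_eq, Prod.fst_add, Prod.snd_add, Φ.sigmaInv_add z.2, pairing_add_left,
      pairing_add_right]
    ring
  smul_left z r v _ w _ := by
    simp only [hopfColeForm_eq, Prod.smul_fst, Prod.smul_snd, Φ.sigmaInv_smul z.2,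
      pairing_smul_left, pairing_smul_right]
    ring
  skew z v _ w _ := by
    simp only [hopfColeForm_eq]
    ring
  descends c₁ c₂ c₁' c₂' hc₁ hc₂ hc₁' hc₂' h h' hr₁ hr₂ := by
    rw [← Φ.wassersteinForm_vel_hopfCole c₁ c₂ hc₁ hc₂ h,
      ← Φ.wassersteinForm_vel_hopfCole c₁' c₂' hc₁' hc₂' h']
    exact isSymplecticForm_wassersteinForm.descends _ _ _ _ (Φ.dSmooth_hopfCole.comp hc₁)
      (Φ.dSmooth_hopfCole.comp hc₂) (Φ.dSmooth_hopfCole.comp hc₁') (Φ.dSmooth_hopfCole.comp hc₂')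
      (congrArg _ h) (congrArg _ h') (fun t => (Φ.rel_hopfCole_iff _ _).1 (hr₁ t))
      (fun t => (Φ.rel_hopfCole_iff _ _).1 (hr₂ t))
  nondegenerate := by
    rintro z _ ⟨c, hc, rfl, rfl⟩ h
    have hfc := Φ.dSmooth_hopfCole.comp hc
    -- The image velocity is vertical in `T^*P(M)`, and the inverse transformation carries the
    -- vertical curve back. Velocities of image curves under the inverse depend only on base point
    -- and velocity, so the original vector is recovered.
    have hvert := isSymplecticForm_wassersteinForm.nondegenerate (Φ.hopfCole (c 0))
      ((cotangentBundle μ).vel fun t => Φ.hopfCole (c t)) ⟨_, hfc, rfl, rfl⟩ ?_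
    · obtain ⟨b, hb, hb0, hrel, hvel⟩ := hvert
      refine ⟨fun t => Φ.hopfColeInv (b t), Φ.dSmooth_hopfColeInv.comp hb, ?_, fun t => ?_, ?_⟩
      · simp only [hb0, hopfColeInv_hopfCole]
      · rw [rel_hopfCole_iff, hopfCole_hopfColeInv]
        exact hrel t
      · have h1 := Φ.vel_hopfColeInv hfc
        simp only [Function.comp_apply, hopfColeInv_hopfCole] at h1
        rw [Φ.vel_hopfColeInv hb, hb0, hvel]
        exact h1.symm
    -- Every test curve `b` in `T^*P(M)` is the image of a curve of Hopf–Cole variables, so the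
    -- hypothesis on `v` applies to it.
    · rintro _ ⟨b, hb, hb0, rfl⟩
      have hb' := Φ.dSmooth_hopfColeInv.comp hb
      have h0 : c 0 = Φ.hopfColeInv (b 0) := by rw [hb0, hopfColeInv_hopfCole]
      have h1 := Φ.wassersteinForm_vel_hopfCole c _ hc hb' h0
      simp only [Function.comp_apply, hopfCole_hopfColeInv] at h1
      rw [h1]
      exact h _ ⟨_, hb', h0.symm, rfl⟩
  smooth n p hp a b := by
    rw [Φ.pullbackCoeff_hopfColeForm hp]
    exact isSymplecticForm_wassersteinForm.smooth n _ (Φ.dSmooth_hopfCole n p hp) a b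
  closed n p hp a b c u := by
    simp only [Φ.pullbackCoeff_hopfColeForm hp]
    exact isSymplecticForm_wassersteinForm.closed n _ (Φ.dSmooth_hopfCole n p hp) a b c u

theorem isSymplectomorphism_hopfCole [μ.IsOpenPosMeasure] :
    Φ.hopfColeSpace.IsSymplectomorphism (cotangentBundle μ) Φ.hopfColeForm (wassersteinForm μ)
      Φ.hopfCole where
  symplectic_source := Φ.isSymplecticForm_hopfColeForm
  symplectic_target := isSymplecticForm_wassersteinForm
  smooth := Φ.dSmooth_hopfCole
  diffeo := Φ.exists_equiv_points
  pullback := Φ.wassersteinForm_vel_hopfCole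

end InvertiblePotential

end HopfCole

theorem mainTheorem1 {d : ℕ} {M : Type*} [TopologicalSpace M] [T2Space M] [CompactSpace M]
    [ChartedSpace (EuclideanSpace ℝ (Fin d)) M] [IsManifold (𝓡 d) ∞ M]
    [MeasurableSpace M] [BorelSpace M]
    (μ : Measure M) [IsFiniteMeasure μ] [μ.IsOpenPosMeasure]
    (Φ : HopfCole.InvertiblePotential d μ) :
    (∀ η ∈ Φ.dom, Function.Bijective (Φ.secondVariation η)) ∧
    (∀ z ∈ Φ.hopfColeSpace.carrier, Function.Bijective (Φ.sigma z)) ∧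
    (∀ z : Φ.hopfColeSpace.carrier,
      Φ.δF (Φ.hopfCole z).1.1 = Φ.δF z.1.1 + Φ.δF z.1.2 ∧
      (Φ.hopfCole z).1.2 = Φ.δF z.1.1 - Φ.δF z.1.2) ∧
    HopfCole.PhaseSpace.IsSymplectomorphism Φ.hopfColeSpace (HopfCole.cotangentBundle μ)
      Φ.hopfColeForm (HopfCole.wassersteinForm μ) Φ.hopfCole := by
  exact ⟨fun _ hη => Φ.bijective_secondVariation hη, fun _ hz => Φ.bijective_sigma hz,
    fun z => ⟨Φ.δF_density z.1, rfl⟩, Φ.isSymplectomorphism_hopfCole⟩
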